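/- Let $\varphi:(0,\infty)\to(0,\infty)$ satisfy: (i) $\varphi\in C^1((0,\infty))$; (ii) $(s\varphi(s))'>0$ for all $s>0$; (iii) the range of $s\mapsto s\varphi(s)$ is $(0,\infty)$; (iv) there are $C_1,C_2>0$, $r>-1$ and $s_0>0$ with $C_1s^r\le (s\varphi(s))'\le C_2s^r$ for $s\in(0,s_0)$, and if $r=0$ then moreover the finite limit $\lim_{s\to0^+}\varphi(s)>0$ exists and $\lim_{s\to0^+}s\varphi'(s)=0$; (v) there is $s_1>s_0$ such that $\varphi'\ge0$ on $[s_1,\infty)$ or $\varphi'\le0$ on $[s_1,\infty)$; (vi) $s\mapsto|s\varphi'(s)/\varphi(s)|$ is non-decreasing on $(0,\infty)$. Define $\Lambda$ on $(0,\infty)$ by $$\Lambda\bigl(s\sqrt{\varphi(s)}\bigr)=-\frac{s\varphi'(s)}{s\varphi'(s)+2\varphi(s)}\quad(s>0),\qquad \Lambda_\infty^2:=\sup_{t>0}\Lambda^2(t).$$ Let $-\infty\le a<b\le+\infty$, let $m\ge1$, and let $\mathscr A(x)=\{a_{hk}(x)\}$, $x\in(a,b)$, be an $m\times m$ matrix with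 real entries in $L^1_{\mathrm{loc}}((a,b))$ such that, for almost every $x\in(a,b)$, $\mathscr A(x)$ is symmetric and $\langle\mathscr A(x)\xi,\xi\rangle>0$ for all $\xi\in\mathbb R^m\setminus\{0\}$. The operator $Au=(\mathscr A(x)u')'$ is called $L^\Phi$-dissipative (where $\Phi(s)=\int_0^s\sigma\varphi(\sigma)\,d\sigma$) if $$\operatorname{Re}\int_a^b\bigl\langle \mathscr A u',(\varphi(|u|)u)'\bigr\rangle\,dx\ge0$$ for every $u:(a,b)\to\mathbb C^m$ of class $C^1$ with compact support in $(a,b)$ such that $\varphi(|u|)u$ (set to be $0$ where $u=0$) is also of class $C^1$ with compact support in $(a,b)$. Then $A$ is $L^\Phi$-dissipative if and only if $$\Lambda_\infty^2\,(\mu_1(x)+\mu_m(x))^2\le4\,\mu_1(x)\mu_m(x)\quad\text{for almost every }x\in(a,b),$$ where $\mu_1(x)$ and $\mu_m(x)$ are the smallest and the largest eigenvalues of $\mathscr A(x)$. In the particular case $m=2$ this condition is equivalent to $$\Lambda_\infty^2\,(\operatorname{tr}\mathscr A(x))^2\le4\det\mathscr A(x)\quad\text{for almost every }x\in(a,b).$$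 -/

import Mathlib

open Set Filter Topology MeasureTheory

noncomputable section

namespace PhiDissipativity

/-- The standing conditions on the weight `φ`, a positive function on `(0, ∞)`; the values of `φ`
outside `(0, ∞)` play no role. -/
structure AdmissibleWeight (φ : ℝ → ℝ) : Prop where
  pos : ∀ s, 0 < s → 0 < φ s
  contDiffOn : ContDiffOn ℝ 1 φ (Ioi 0)
  deriv_pos : ∀ s, 0 < s → 0 < deriv (fun σ => σ * φ σ) s
  range_eq : (fun s => s * φ s) '' Ioi 0 = Ioi 0
  behaviour : ∃ r s₀ C₁ C₂ : ℝ, -1 < r ∧ 0 < s₀ ∧ 0 < C₁ ∧ 0 < C₂ ∧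
    (∀ s ∈ Ioo 0 s₀, C₁ * s ^ r ≤ deriv (fun σ => σ * φ σ) s ∧
      deriv (fun σ => σ * φ σ) s ≤ C₂ * s ^ r) ∧
    (r = 0 → (∃ φ₀ : ℝ, 0 < φ₀ ∧ Tendsto φ (𝓝[>] 0) (𝓝 φ₀)) ∧
      Tendsto (fun s => s * deriv φ s) (𝓝[>] 0) (𝓝 0)) ∧
    ∃ s₁, s₀ < s₁ ∧ ((∀ s, s₁ ≤ s → 0 ≤ deriv φ s) ∨ (∀ s, s₁ ≤ s → deriv φ s ≤ 0))
  monotoneOn_ratio : MonotoneOn (fun s => |s * deriv φ s / φ s|) (Ioi 0)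

/-- The inverse of the bijection `s ↦ s √(φ s)` of `(0, ∞)` onto itself (see
`AdmissibleWeight.bijOn`). -/
def invWeight (φ : ℝ → ℝ) : ℝ → ℝ :=
  Function.invFunOn (fun s => s * √(φ s)) (Ioi 0)

/-- The function `Λ` on `(0, ∞)`: `Λ (s √(φ s)) = - s φ'(s) / (s φ'(s) + 2 φ(s))` for `s > 0`
(see `Lambda_apply`). -/
def Lambda (φ : ℝ → ℝ) (t : ℝ) : ℝ :=
  -(invWeight φ t * deriv φ (invWeight φ t)) /
    (invWeight φ t * deriv φ (invWeight φ t) + 2 * φ (invWeight φ t))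

/-- `Λ_∞² = sup_{t > 0} Λ²(t)`; the set is bounded, see `bddAbove_Lambda_sq`. -/
def LambdaInftySq (φ : ℝ → ℝ) : ℝ :=
  sSup ((fun t => Lambda φ t ^ 2) '' Ioi 0)

theorem AdmissibleWeight.strictMonoOn {φ : ℝ → ℝ} (h : AdmissibleWeight φ) :
    StrictMonoOn (fun s => s * φ s) (Ioi 0) := by
  refine strictMonoOn_of_deriv_pos (convex_Ioi 0)
    (continuousOn_id.mul h.contDiffOn.continuousOn) ?_
  intro s hs
  rw [interior_Ioi] at hs
  exact h.deriv_pos s hs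

theorem AdmissibleWeight.bijOn {φ : ℝ → ℝ} (h : AdmissibleWeight φ) :
    BijOn (fun s => s * √(φ s)) (Ioi 0) (Ioi 0) := by
  have hsq : ∀ s, 0 < s → (s * √(φ s)) ^ 2 = s * (s * φ s) := by
    intro s hs
    rw [mul_pow, Real.sq_sqrt (h.pos s hs).le]; ring
  have hpos : ∀ s, 0 < s → 0 < s * √(φ s) := fun s hs =>
    mul_pos hs (Real.sqrt_pos.2 (h.pos s hs))
  have hmono : StrictMonoOn (fun s => s * √(φ s)) (Ioi 0) := by
    intro a ha b hb hab
    refine lt_of_pow_lt_pow_left₀ 2 (hpos b hb).le ?_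
    simp only [hsq a ha, hsq b hb]
    exact mul_lt_mul hab (h.strictMonoOn ha hb hab).le
      (mul_pos ha (h.pos a ha)) (le_of_lt hb)
  refine ⟨fun s hs => hpos s hs, hmono.injOn, ?_⟩
  intro t ht
  have ht' : (0 : ℝ) < t := ht
  obtain ⟨a, ha, hat⟩ : t ∈ (fun s => s * φ s) '' Ioi 0 := by rw [h.range_eq]; exact ht
  have ha' : (0 : ℝ) < a := ha
  simp only at hat
  have hsub : uIcc a t ⊆ Ioi 0 := fun s hs => lt_of_lt_of_le (lt_min ha' ht') hs.1
  have hcont : ContinuousOn (fun s => s * √(φ s)) (uIcc a t) :=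
    continuousOn_id.mul ((h.contDiffOn.continuousOn.mono hsub).sqrt)
  have hmem : t ∈ uIcc (a * √(φ a)) (t * √(φ t)) := by
    have h1 := hsq a ha'
    have h2 := hsq t ht'
    rw [hat] at h1
    rcases le_total a t with hle | hle
    · have h3 : t ≤ t * φ t := by
        have := h.strictMonoOn.monotoneOn ha ht hle
        simpa [hat] using this
      refine mem_uIcc.2 (Or.inl ⟨?_, ?_⟩)
      · exact (sq_le_sq₀ (by positivity) (by positivity)).1 (by nlinarith)
      · exact (sq_le_sq₀ (by positivity) (by positivity)).1 (by nlinarith)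
    · have h3 : t * φ t ≤ t := by
        have := h.strictMonoOn.monotoneOn ht ha hle
        simpa [hat] using this
      refine mem_uIcc.2 (Or.inr ⟨?_, ?_⟩)
      · exact (sq_le_sq₀ (by positivity) (by positivity)).1 (by nlinarith)
      · exact (sq_le_sq₀ (by positivity) (by positivity)).1 (by nlinarith)
  obtain ⟨s, hs, hst⟩ := intermediate_value_uIcc hcont hmem
  exact ⟨s, hsub hs, hst⟩

theorem Lambda_apply {φ : ℝ → ℝ} (h : AdmissibleWeight φ) {s : ℝ} (hs : 0 < s) :
    Lambda φ (s * √(φ s)) = -(s * deriv φ s) / (s * deriv φ s + 2 * φ s) := by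
  have : invWeight φ (s * √(φ s)) = s :=
    h.bijOn.invOn_invFunOn.1 hs
  simp only [Lambda, this]

theorem bddAbove_Lambda_sq {φ : ℝ → ℝ} (h : AdmissibleWeight φ) :
    BddAbove ((fun t => Lambda φ t ^ 2) '' Ioi 0) := by
  refine ⟨1, ?_⟩
  rintro _ ⟨t, ht, rfl⟩
  obtain ⟨s, hs, rfl⟩ := h.bijOn.surjOn ht
  have hs' : (0 : ℝ) < s := hs
  have hd : DifferentiableAt ℝ φ s :=
    (h.contDiffOn.differentiableOn one_ne_zero).differentiableAt (Ioi_mem_nhds hs')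
  have h1 := h.deriv_pos s hs
  have h2 : deriv (fun σ => σ * φ σ) s = φ s + s * deriv φ s := by
    have := (hasDerivAt_id' s).fun_mul hd.hasDerivAt
    simpa using this.deriv
  rw [h2] at h1
  have h3 := h.pos s hs
  simp only [Lambda_apply h hs']
  rw [div_pow, div_le_one (by nlinarith)]
  nlinarith

/-- `u ∈ [C¹_c(I)]^m`; functions with compact support in `I` are extended by zero to `ℝ`. -/
def TestFunction {m : ℕ} (I : Set ℝ) (u : ℝ → EuclideanSpace ℂ (Fin m)) : Prop :=
  ContDiff ℝ 1 u ∧ HasCompactSupport u ∧ tsupport u ⊆ I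

/-- The operator `A u = (𝒜 u')'` on the open set `I ⊆ ℝ` is `L^Φ`-dissipative:
`Re ∫_I ⟨𝒜 u', (φ(|u|) u)'⟩ dx ≥ 0` for every `u ∈ [C¹_c(I)]^m` such that `φ(|u|) u ∈ [C¹_c(I)]^m`.
The Hermitian product is
antilinear in the second argument, which is the first argument of `inner`. -/
def LPhiDissipative {m : ℕ} (φ : ℝ → ℝ) (I : Set ℝ) (𝒜 : ℝ → Matrix (Fin m) (Fin m) ℂ) : Prop :=
  ∀ u : ℝ → EuclideanSpace ℂ (Fin m), TestFunction I u →
    TestFunction I (fun x => φ ‖u x‖ • u x) →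
    0 ≤ (∫ x in I, inner ℂ (deriv (fun y => φ ‖u y‖ • u y) x)
      (Matrix.toEuclideanCLM (𝕜 := ℂ) (𝒜 x) (deriv u x))).re

/-- The smallest eigenvalue of a real symmetric matrix of positive size. -/
def minEigenvalue {m : ℕ} (M : Matrix (Fin m) (Fin m) ℝ) : ℝ :=
  sInf {μ : ℝ | Module.End.HasEigenvalue (Matrix.toLin' M) μ}

/-- The largest eigenvalue of a real symmetric matrix of positive size. -/
def maxEigenvalue {m : ℕ} (M : Matrix (Fin m) (Fin m) ℝ) : ℝ :=
  sSup {μ : ℝ | Module.End.HasEigenvalue (Matrix.toLin' M) μ}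

/-- The bounded or unbounded open interval `(a, b) ⊆ ℝ`, with endpoints in `[-∞, ∞]`. -/
def openInterval (a b : EReal) : Set ℝ := {x : ℝ | a < (x : EReal) ∧ (x : EReal) < b}

end PhiDissipativity

end

/-! Where `u ≠ 0`, put `s = |u|`, `ω = u/s`, `ξ = u'`, `η = 𝒜ξ`. The real part of the integrand is
then `energyForm`, that is `φ(s)⟨η,ξ⟩ + sφ'(s)⟨ω,ξ⟩⟨η,ω⟩` with real inner products on `ℂ^m`. The
theorem splits into algebra for this form and a localization argument.

Algebra (`forall_energyForm_nonneg_iff`): over unit vectors `ω` the product `⟨ω,ξ⟩⟨η,ω⟩` has extreme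
values `(⟨η,ξ⟩ ± |ξ||η|)/2`, attained at the bisectors of `ξ` and `±η`. So nonnegativity in all
directions at radius `s` means `|sφ'||ξ||η| ≤ (sφ' + 2φ)⟨η,ξ⟩`, or `|Λ||ξ||η| ≤ ⟨η,ξ⟩`. By the
Kantorovich inequality the least cosine of the angle between `ξ` and `𝒜ξ` is `2√(μ₁μₘ)/(μ₁+μₘ)`,
which gives the stated condition.

Localization: a form nonnegative almost everywhere integrates to a nonnegative number
(`lPhiDissipative_of_ae`). Conversely, fix `v ≠ 0` and `ξ`, and test with `g v + β ξ`, where `g = 1`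
near the support of `β`. The energy is a constant independent of `β` plus `∫ β'² energyForm(𝒜ξ, v +
βξ, ξ)` (`LPhiDissipative.exists_add_integral_nonneg`). A small, rapidly oscillating `β` with large
slope isolates the integral with `β` replaced by `0` inside the form (`setIntegral_sq_mul_nonneg`).
Sign and density arguments then give the pointwise inequality. -/

noncomputable section

namespace PhiDissipativity

/-! ### The quadratic form for fixed vectors. -/

section RealInner

variable {V : Type*} [NormedAddCommGroup V] [InnerProductSpace ℝ V]

/-- The real part of `⟨𝒜 u', (φ(|u|) u)'⟩` at a point where `u = v ≠ 0`, `u' = ξ` and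
`𝒜 u' = η`. -/
def energyForm (φ : ℝ → ℝ) (η v ξ : V) : ℝ :=
  φ ‖v‖ * inner ℝ η ξ + deriv φ ‖v‖ / ‖v‖ * (inner ℝ v ξ * inner ℝ η v)

/-- The vector `2⟨v,ξ⟩v - |v|²ξ` is `|v|²` times the reflection of `ξ` in the line `ℝv`, so it has
norm `|v|²|ξ|`; Cauchy–Schwarz against `η` does the rest. -/
theorem abs_two_mul_inner_mul_inner_sub_le (v ξ η : V) :
    |2 * (inner ℝ v ξ * inner ℝ η v) - ‖v‖ ^ 2 * inner ℝ η ξ| ≤ ‖v‖ ^ 2 * (‖ξ‖ * ‖η‖) := by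
  have hn : ‖(2 * inner ℝ v ξ) • v - (‖v‖ ^ 2) • ξ‖ = ‖v‖ ^ 2 * ‖ξ‖ := by
    rw [← sq_eq_sq₀ (norm_nonneg _) (by positivity), norm_sub_sq_real, norm_smul, norm_smul,
      inner_smul_left, inner_smul_right, mul_pow, mul_pow, Real.norm_eq_abs, Real.norm_eq_abs,
      sq_abs, sq_abs]
    simp only [conj_trivial]
    ring
  have h := abs_real_inner_le_norm ((2 * inner ℝ v ξ) • v - (‖v‖ ^ 2) • ξ) η
  rw [hn, inner_sub_left, inner_smul_left, inner_smul_left, real_inner_comm η v,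
    real_inner_comm η ξ] at h
  simp only [conj_trivial] at h
  convert h using 1
  · congr 1; ring
  · ring

theorem energyForm_nonneg {φ : ℝ → ℝ} {η v ξ : V} (hv : v ≠ 0)
    (h : |‖v‖ * deriv φ ‖v‖| * (‖ξ‖ * ‖η‖) ≤
      (‖v‖ * deriv φ ‖v‖ + 2 * φ ‖v‖) * inner ℝ η ξ) : 0 ≤ energyForm φ η v ξ := by
  have hs : 0 < ‖v‖ := norm_pos_iff.2 hv
  have h1 := abs_two_mul_inner_mul_inner_sub_le v ξ η
  have h2 : |deriv φ ‖v‖ / ‖v‖ * (2 * (inner ℝ v ξ * inner ℝ η v) - ‖v‖ ^ 2 * inner ℝ η ξ)| ≤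
      |‖v‖ * deriv φ ‖v‖| * (‖ξ‖ * ‖η‖) := by
    rw [abs_mul, abs_div, abs_of_pos hs]
    calc |deriv φ ‖v‖| / ‖v‖ * _ ≤ |deriv φ ‖v‖| / ‖v‖ * (‖v‖ ^ 2 * (‖ξ‖ * ‖η‖)) := by gcongr
      _ = _ := by rw [abs_mul, abs_of_pos hs]; field_simp
  have h3 := neg_abs_le
    (deriv φ ‖v‖ / ‖v‖ * (2 * (inner ℝ v ξ * inner ℝ η v) - ‖v‖ ^ 2 * inner ℝ η ξ))
  have h4 : 2 * energyForm φ η v ξ = 2 * φ ‖v‖ * inner ℝ η ξ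
      + deriv φ ‖v‖ / ‖v‖ * (2 * (inner ℝ v ξ * inner ℝ η v) - ‖v‖ ^ 2 * inner ℝ η ξ)
      + ‖v‖ * deriv φ ‖v‖ * inner ℝ η ξ := by
    unfold energyForm
    field_simp
    ring
  nlinarith

/-- Converse of `energyForm_nonneg` at radius `s`. Since `|η| = p|ξ|`, the vector `pξ ± η` bisects
`ξ` and `±η`, where the form is extremal; the sign is chosen opposite to that of `φ'(s)`. -/
theorem abs_mul_le_of_energyForm_nonneg {φ : ℝ → ℝ} {η ξ : V} {s p : ℝ} (hs : 0 < s) (hp : 0 < p)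
    (hφ : |s * deriv φ s| ≤ s * deriv φ s + 2 * φ s) (hY : 0 ≤ inner ℝ η ξ)
    (hη : ‖η‖ ^ 2 = p ^ 2 * ‖ξ‖ ^ 2) (h : ∀ v : V, v ≠ 0 → 0 ≤ energyForm φ η v ξ) :
    |s * deriv φ s| * (p * ‖ξ‖ ^ 2) ≤ (s * deriv φ s + 2 * φ s) * inner ℝ η ξ := by
  have key : ∀ σ : ℝ, σ ^ 2 = 1 → p • ξ + σ • η ≠ 0 →
      0 ≤ 2 * φ s * inner ℝ η ξ + s * deriv φ s * (σ * p * ‖ξ‖ ^ 2 + inner ℝ η ξ) := by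
    intro σ hσ h0
    set w := p • ξ + σ • η with hw
    have hwn : 0 < ‖w‖ := norm_pos_iff.2 h0
    have h1 : inner ℝ w ξ = p * ‖ξ‖ ^ 2 + σ * inner ℝ η ξ := by
      rw [hw, inner_add_left, inner_smul_left, inner_smul_left, real_inner_self_eq_norm_sq]
      simp
    have h2 : inner ℝ η w = p * inner ℝ η ξ + σ * (p ^ 2 * ‖ξ‖ ^ 2) := by
      rw [hw, inner_add_right, inner_smul_right, inner_smul_right, real_inner_self_eq_norm_sq, hη]
    have h3 : ‖w‖ ^ 2 = p * inner ℝ w ξ + σ * inner ℝ η w := by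
      rw [← real_inner_self_eq_norm_sq]
      nth_rewrite 2 [hw]
      rw [inner_add_right, inner_smul_right, inner_smul_right, real_inner_comm η w]
    have h4 := h ((s / ‖w‖) • w) (smul_ne_zero (by positivity) h0)
    have h5 : ‖(s / ‖w‖) • w‖ = s := by
      rw [norm_smul, Real.norm_eq_abs, abs_of_pos (by positivity)]; field_simp
    rw [energyForm, h5, inner_smul_left, inner_smul_right, conj_trivial] at h4
    have h6 : inner ℝ w ξ * inner ℝ η w =
        ‖w‖ ^ 2 * ((σ * p * ‖ξ‖ ^ 2 + inner ℝ η ξ) / 2) := by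
      rw [h3, h1, h2]
      linear_combination (-(p ^ 2 * ‖ξ‖ ^ 2 * inner ℝ η ξ + σ * p ^ 3 * ‖ξ‖ ^ 4) / 2) * hσ
    have h7 : deriv φ s / s * (s / ‖w‖ * inner ℝ w ξ * (s / ‖w‖ * inner ℝ η w)) =
        s * deriv φ s * ((σ * p * ‖ξ‖ ^ 2 + inner ℝ η ξ) / 2) := by
      calc _ = s * deriv φ s / ‖w‖ ^ 2 * (inner ℝ w ξ * inner ℝ η w) := by field_simp
        _ = _ := by rw [h6]; field_simp
    rw [h7] at h4
    linarith
  -- If the bisector vanishes, `η` is parallel to `ξ`, and `0 ≤ ⟨η,ξ⟩` forces equality in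
  -- Cauchy–Schwarz; the claim then reduces to `hφ`.
  have degenerate : ∀ σ : ℝ, σ ^ 2 = 1 → p • ξ + σ • η = 0 → inner ℝ η ξ = p * ‖ξ‖ ^ 2 := by
    intro σ hσ h0
    have h1 : inner ℝ (p • ξ + σ • η) ξ = 0 := by rw [h0, inner_zero_left]
    rw [inner_add_left, inner_smul_left, inner_smul_left, real_inner_self_eq_norm_sq] at h1
    simp only [conj_trivial] at h1
    have h2 : 0 ≤ p * ‖ξ‖ ^ 2 := by positivity
    rcases sq_eq_sq_iff_eq_or_eq_neg.1 (hσ.trans (one_pow 2).symm) with rfl | rfl <;> linarith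
  have hX : 0 ≤ p * ‖ξ‖ ^ 2 := by positivity
  have main : ∀ σ : ℝ, σ ^ 2 = 1 → |s * deriv φ s| = -σ * (s * deriv φ s) →
      |s * deriv φ s| * (p * ‖ξ‖ ^ 2) ≤ (s * deriv φ s + 2 * φ s) * inner ℝ η ξ := by
    intro σ hσ ha
    by_cases h0 : p • ξ + σ • η = 0
    · rw [degenerate σ hσ h0]
      gcongr
    · have := key σ hσ h0
      rw [ha]
      linarith
  rcases le_total 0 (s * deriv φ s) with hd | hd
  · exact main (-1) (by norm_num) (by rw [abs_of_nonneg hd]; ring)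
  · exact main 1 (by norm_num) (by rw [abs_of_nonpos hd]; ring)

end RealInner

/-! ### Real symmetric matrices: extreme eigenvalues and the Kantorovich inequality. -/

section Matrix

variable {m : ℕ}

/-- The operator on `ℂ^m` defined by a real matrix. -/
abbrev complexOp (M : Matrix (Fin m) (Fin m) ℝ) :
    EuclideanSpace ℂ (Fin m) →L[ℂ] EuclideanSpace ℂ (Fin m) :=
  Matrix.toEuclideanCLM (𝕜 := ℂ) (M.map Complex.ofReal)

theorem re_inner_complex (x y : EuclideanSpace ℂ (Fin m)) :
    (inner ℂ x y).re = inner ℝ x y := by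
  simp only [PiLp.inner_apply, Complex.re_sum]
  rfl

theorem inner_real_eq_dotProduct (x y : EuclideanSpace ℂ (Fin m)) :
    inner ℝ x y = (fun i => (x i).re) ⬝ᵥ (fun i => (y i).re) +
      (fun i => (x i).im) ⬝ᵥ (fun i => (y i).im) := by
  simp only [PiLp.inner_apply, dotProduct, ← Finset.sum_add_distrib, Complex.inner,
    Complex.mul_re, Complex.conj_re, Complex.conj_im]
  refine Finset.sum_congr rfl fun i _ => by ring

theorem complexOp_apply_re (M : Matrix (Fin m) (Fin m) ℝ) (x : EuclideanSpace ℂ (Fin m)) :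
    (fun i => (complexOp M x i).re) = M.mulVec (fun i => (x i).re) := by
  ext i
  simp [Matrix.mulVec, dotProduct]

theorem complexOp_apply_im (M : Matrix (Fin m) (Fin m) ℝ) (x : EuclideanSpace ℂ (Fin m)) :
    (fun i => (complexOp M x i).im) = M.mulVec (fun i => (x i).im) := by
  ext i
  simp [Matrix.mulVec, dotProduct]

theorem isHermitian_of_isSymm {M : Matrix (Fin m) (Fin m) ℝ} (hM : M.IsSymm) : M.IsHermitian := by
  rw [Matrix.IsHermitian, Matrix.conjTranspose_eq_transpose_of_trivial]; exact hM

theorem setOf_hasEigenvalue_eq {M : Matrix (Fin m) (Fin m) ℝ} (hM : M.IsHermitian) :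
    {μ : ℝ | Module.End.HasEigenvalue (Matrix.toLin' M) μ} = Set.range hM.eigenvalues := by
  ext μ
  rw [mem_ofPred_eq, Module.End.hasEigenvalue_iff_mem_spectrum, Matrix.spectrum_toLin',
    hM.spectrum_real_eq_range_eigenvalues]

theorem eigenvalues_mem_Icc {M : Matrix (Fin m) (Fin m) ℝ} (hM : M.IsHermitian) (i : Fin m) :
    hM.eigenvalues i ∈ Icc (minEigenvalue M) (maxEigenvalue M) := by
  rw [minEigenvalue, maxEigenvalue, setOf_hasEigenvalue_eq hM]
  exact ⟨csInf_le (finite_range _).bddBelow ⟨i, rfl⟩, le_csSup (finite_range _).bddAbove ⟨i, rfl⟩⟩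

theorem exists_eigenvalues_eq {M : Matrix (Fin m) (Fin m) ℝ} (hM : M.IsHermitian) (hm : 1 ≤ m) :
    ∃ i j, hM.eigenvalues i = minEigenvalue M ∧ hM.eigenvalues j = maxEigenvalue M := by
  have : Nonempty (Fin m) := ⟨⟨0, hm⟩⟩
  rw [minEigenvalue, maxEigenvalue, setOf_hasEigenvalue_eq hM]
  obtain ⟨i, hi⟩ := (range_nonempty hM.eigenvalues).csInf_mem (finite_range _)
  obtain ⟨j, hj⟩ := (range_nonempty hM.eigenvalues).csSup_mem (finite_range _)
  exact ⟨i, j, hi, hj⟩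

theorem eigenvalues_pos {M : Matrix (Fin m) (Fin m) ℝ} (hM : M.IsHermitian)
    (hpos : ∀ ξ : Fin m → ℝ, ξ ≠ 0 → 0 < M.mulVec ξ ⬝ᵥ ξ) (i : Fin m) : 0 < hM.eigenvalues i := by
  have h0 : (hM.eigenvectorBasis i).ofLp ≠ 0 := fun h =>
    hM.eigenvectorBasis.orthonormal.ne_zero i (by ext k; simpa using congrFun h k)
  have h1 := hpos _ h0
  rw [hM.mulVec_eigenvectorBasis, smul_dotProduct, smul_eq_mul] at h1
  have h2 : 0 ≤ (hM.eigenvectorBasis i).ofLp ⬝ᵥ (hM.eigenvectorBasis i).ofLp :=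
    Finset.sum_nonneg fun k _ => mul_self_nonneg _
  exact pos_of_mul_pos_left h1 h2

/-- In an eigenbasis this is `(λ - μ₁)(μₘ - λ) ≥ 0` for each eigenvalue `λ`, weighted by the squared
coordinates. -/
theorem mulVec_dotProduct_mulVec_le {M : Matrix (Fin m) (Fin m) ℝ} (hM : M.IsHermitian)
    (x : Fin m → ℝ) :
    M.mulVec x ⬝ᵥ M.mulVec x ≤ (minEigenvalue M + maxEigenvalue M) * (M.mulVec x ⬝ᵥ x) -
      minEigenvalue M * maxEigenvalue M * (x ⬝ᵥ x) := by
  have hin : ∀ y z : EuclideanSpace ℝ (Fin m), inner ℝ y z = y.ofLp ⬝ᵥ z.ofLp := by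
    intro y z
    simp [PiLp.inner_apply, dotProduct, mul_comm]
  set b := hM.eigenvectorBasis with hb
  set c : Fin m → ℝ := fun i => inner ℝ (b i) (WithLp.toLp 2 x) with hc
  have hco : ∀ i, inner ℝ (b i) (WithLp.toLp 2 (M.mulVec x)) = hM.eigenvalues i * c i := by
    intro i
    rw [hc]
    simp only [hin]
    rw [Matrix.dotProduct_mulVec, ← Matrix.mulVec_transpose,
      ← Matrix.conjTranspose_eq_transpose_of_trivial, hM.eq, hM.mulVec_eigenvectorBasis,
      smul_dotProduct, smul_eq_mul]
  have hdot : ∀ y z : Fin m → ℝ, y ⬝ᵥ z =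
      ∑ i, inner ℝ (b i) (WithLp.toLp 2 y) * inner ℝ (b i) (WithLp.toLp 2 z) := by
    intro y z
    have := b.sum_inner_mul_inner (WithLp.toLp 2 y) (WithLp.toLp 2 z)
    rw [hin] at this
    rw [← this]
    exact Finset.sum_congr rfl fun i _ => by rw [real_inner_comm]
  rw [hdot, hdot, hdot, Finset.mul_sum, Finset.mul_sum, ← Finset.sum_sub_distrib]
  refine Finset.sum_le_sum fun i _ => ?_
  rw [hco]
  have h1 := eigenvalues_mem_Icc hM i
  have h2 := mul_nonneg (sub_nonneg.2 h1.1) (sub_nonneg.2 h1.2)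
  have h3 := mul_nonneg h2 (mul_self_nonneg (c i))
  linarith

theorem norm_complexOp_sq_le {M : Matrix (Fin m) (Fin m) ℝ} (hM : M.IsHermitian)
    (ξ : EuclideanSpace ℂ (Fin m)) :
    ‖complexOp M ξ‖ ^ 2 ≤ (minEigenvalue M + maxEigenvalue M) * inner ℝ (complexOp M ξ) ξ -
      minEigenvalue M * maxEigenvalue M * ‖ξ‖ ^ 2 := by
  rw [← real_inner_self_eq_norm_sq, ← real_inner_self_eq_norm_sq, inner_real_eq_dotProduct,
    inner_real_eq_dotProduct, inner_real_eq_dotProduct, complexOp_apply_re, complexOp_apply_im]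
  have h1 := mulVec_dotProduct_mulVec_le hM (fun i => (ξ i).re)
  have h2 := mulVec_dotProduct_mulVec_le hM (fun i => (ξ i).im)
  linarith

/-- An antieigenvector, realizing equality in the Kantorovich inequality. -/
theorem exists_antieigenvector {M : Matrix (Fin m) (Fin m) ℝ} (hM : M.IsHermitian) (hm : 1 ≤ m)
    (hpos : ∀ ξ : Fin m → ℝ, ξ ≠ 0 → 0 < M.mulVec ξ ⬝ᵥ ξ)
    (hne : minEigenvalue M ≠ maxEigenvalue M) :
    ∃ ξ : EuclideanSpace ℂ (Fin m), ‖ξ‖ ^ 2 = minEigenvalue M + maxEigenvalue M ∧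
      inner ℝ (complexOp M ξ) ξ = 2 * (minEigenvalue M * maxEigenvalue M) ∧
      ‖complexOp M ξ‖ ^ 2 = minEigenvalue M * maxEigenvalue M * ‖ξ‖ ^ 2 := by
  obtain ⟨i, j, hi, hj⟩ := exists_eigenvalues_eq hM hm
  have hi0 := eigenvalues_pos hM hpos i
  have hj0 := eigenvalues_pos hM hpos j
  have hij : i ≠ j := by rintro rfl; exact hne (hi.symm.trans hj)
  rw [hi] at hi0
  rw [hj] at hj0
  have hin : ∀ k l, (hM.eigenvectorBasis k).ofLp ⬝ᵥ (hM.eigenvectorBasis l).ofLp =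
      if k = l then 1 else 0 := by
    intro k l
    rw [← orthonormal_iff_ite.1 hM.eigenvectorBasis.orthonormal k l]
    simp [PiLp.inner_apply, dotProduct, mul_comm]
  have hei := hM.mulVec_eigenvectorBasis i
  have hej := hM.mulVec_eigenvectorBasis j
  rw [hi] at hei
  rw [hj] at hej
  generalize minEigenvalue M = μ at *
  generalize maxEigenvalue M = ν at *
  set e := (hM.eigenvectorBasis i).ofLp with he
  set f := (hM.eigenvectorBasis j).ofLp with hf
  have hee : e ⬝ᵥ e = 1 := by rw [hin]; simp
  have hff : f ⬝ᵥ f = 1 := by rw [hin]; simp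
  have hef : e ⬝ᵥ f = 0 := by rw [hin]; simp [hij]
  have hfe : f ⬝ᵥ e = 0 := by rw [hin]; simp [hij.symm]
  -- Each unit eigenvector is weighted by the root of the other eigenvalue, which makes the
  -- coordinatewise inequality an equality and also gives `|My|² = μν|y|²`.
  set y : Fin m → ℝ := √ν • e + √μ • f with hy
  have hMy : M.mulVec y = (√ν * μ) • e + (√μ * ν) • f := by
    rw [hy, Matrix.mulVec_add, Matrix.mulVec_smul, Matrix.mulVec_smul, hei, hej, smul_smul,
      smul_smul]
  have h1 : √ν ^ 2 = ν := Real.sq_sqrt hj0.le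
  have h2 : √μ ^ 2 = μ := Real.sq_sqrt hi0.le
  have comb : ∀ α β γ δ : ℝ, (α • e + β • f) ⬝ᵥ (γ • e + δ • f) = α * γ + β * δ := by
    intro α β γ δ
    simp only [add_dotProduct, dotProduct_add, smul_dotProduct, dotProduct_smul, hee, hff, hef,
      hfe, smul_eq_mul]
    ring
  set ξ : EuclideanSpace ℂ (Fin m) := WithLp.toLp 2 (fun k => (y k : ℂ)) with hξ
  have hre : (fun k => (ξ k).re) = y := by ext k; simp [hξ]
  have him : (fun k => (ξ k).im) = 0 := by ext k; simp [hξ]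
  refine ⟨ξ, ?_, ?_, ?_⟩
  · rw [← real_inner_self_eq_norm_sq, inner_real_eq_dotProduct, hre, him, hy, comb]
    simp
    linarith
  · rw [inner_real_eq_dotProduct, complexOp_apply_re, complexOp_apply_im, hre, him, hMy]
    nth_rewrite 1 [hy]
    rw [comb]
    simp
    linear_combination μ * h1 + ν * h2
  · rw [← real_inner_self_eq_norm_sq, ← real_inner_self_eq_norm_sq, inner_real_eq_dotProduct,
      inner_real_eq_dotProduct, complexOp_apply_re, complexOp_apply_im, hre, him, hMy, hy, comb,
      comb]
    simp
    linear_combination (μ ^ 2 - μ * ν) * h1 + (ν ^ 2 - μ * ν) * h2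

theorem eigenvalue_sum_prod_of_two {M : Matrix (Fin 2) (Fin 2) ℝ} (hM : M.IsHermitian) :
    minEigenvalue M + maxEigenvalue M = M.trace ∧ minEigenvalue M * maxEigenvalue M = M.det := by
  have h1 := hM.trace_eq_sum_eigenvalues
  have h2 := hM.det_eq_prod_eigenvalues
  obtain ⟨i, j, hi, hj⟩ := exists_eigenvalues_eq hM one_le_two
  have h3 := eigenvalues_mem_Icc hM 0
  have h4 := eigenvalues_mem_Icc hM 1
  rw [h1, h2]
  simp only [Fin.sum_univ_two, Fin.prod_univ_two, RCLike.ofReal_real_eq_id, id]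
  rcases le_total (hM.eigenvalues 0) (hM.eigenvalues 1) with h | h
  · have h5 : minEigenvalue M = hM.eigenvalues 0 := le_antisymm h3.1 <| by
      rw [← hi]; fin_cases i <;> simp [h]
    have h6 : maxEigenvalue M = hM.eigenvalues 1 := le_antisymm (by
      rw [← hj]; fin_cases j <;> simp [h]) h4.2
    rw [h5, h6]; exact ⟨rfl, rfl⟩
  · have h5 : minEigenvalue M = hM.eigenvalues 1 := le_antisymm h4.1 <| by
      rw [← hi]; fin_cases i <;> simp [h]
    have h6 : maxEigenvalue M = hM.eigenvalues 0 := le_antisymm (by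
      rw [← hj]; fin_cases j <;> simp [h]) h3.2
    rw [h5, h6]; exact ⟨add_comm _ _, mul_comm _ _⟩

end Matrix

/-! ### From the supremum of `Λ²` to an inequality for every `s`. -/

section Weight

variable {φ : ℝ → ℝ}

theorem AdmissibleWeight.differentiableAt (h : AdmissibleWeight φ) {s : ℝ} (hs : 0 < s) :
    DifferentiableAt ℝ φ s :=
  (h.contDiffOn.differentiableOn one_ne_zero).differentiableAt (Ioi_mem_nhds hs)

theorem AdmissibleWeight.hasDerivAt_mul (h : AdmissibleWeight φ) {s : ℝ} (hs : 0 < s) :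
    HasDerivAt (fun σ => σ * φ σ) (φ s + s * deriv φ s) s := by
  simpa using (hasDerivAt_id' s).fun_mul (h.differentiableAt hs).hasDerivAt

theorem AdmissibleWeight.add_pos (h : AdmissibleWeight φ) {s : ℝ} (hs : 0 < s) :
    0 < φ s + s * deriv φ s := by
  rw [← (h.hasDerivAt_mul hs).deriv]; exact h.deriv_pos s hs

theorem AdmissibleWeight.abs_le (h : AdmissibleWeight φ) {s : ℝ} (hs : 0 < s) :
    |s * deriv φ s| ≤ s * deriv φ s + 2 * φ s := by
  have h1 := h.add_pos hs
  have h2 := h.pos s hs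
  rw [_root_.abs_le]
  constructor <;> linarith

/-- As `s ↦ s√φ(s)` is onto `(0,∞)`, the supremum runs over all `s > 0`; one takes square roots and
clears the positive denominator `sφ' + 2φ`. -/
theorem LambdaInftySq_mul_le_iff (h : AdmissibleWeight φ) {P R : ℝ} (hP : 0 ≤ P) (hR : 0 ≤ R) :
    LambdaInftySq φ * P ^ 2 ≤ R ^ 2 ↔
      ∀ s, 0 < s → |s * deriv φ s| * P ≤ (s * deriv φ s + 2 * φ s) * R := by
  have hterm : ∀ s, 0 < s → (Lambda φ (s * √(φ s)) ^ 2 * P ^ 2 ≤ R ^ 2 ↔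
      |s * deriv φ s| * P ≤ (s * deriv φ s + 2 * φ s) * R) := by
    intro s hs
    have hd : 0 < s * deriv φ s + 2 * φ s := by linarith [h.add_pos hs, h.pos s hs]
    rw [Lambda_apply h hs, ← mul_pow, sq_le_sq, abs_mul, abs_div, abs_neg, abs_of_pos hd,
      abs_of_nonneg hP, abs_of_nonneg hR, div_mul_eq_mul_div, div_le_iff₀ hd, mul_comm R]
  constructor
  · intro hle s hs
    refine (hterm s hs).1 (le_trans ?_ hle)
    gcongr
    exact le_csSup (bddAbove_Lambda_sq h) ⟨_, h.bijOn.mapsTo hs, rfl⟩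
  · intro hall
    rcases hP.eq_or_lt with rfl | hP'
    · simp [sq_nonneg]
    rw [← le_div_iff₀ (by positivity)]
    refine csSup_le (nonempty_Ioi.image _) ?_
    rintro _ ⟨t, ht, rfl⟩
    obtain ⟨s, hs, rfl⟩ := h.bijOn.surjOn ht
    rw [le_div_iff₀ (by positivity)]
    exact (hterm s hs).2 (hall s hs)

end Weight

theorem forall_energyForm_nonneg_iff {φ : ℝ → ℝ} (hφ : AdmissibleWeight φ) {m : ℕ} (hm : 1 ≤ m)
    {M : Matrix (Fin m) (Fin m) ℝ} (hM : M.IsSymm)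
    (hpos : ∀ ξ : Fin m → ℝ, ξ ≠ 0 → 0 < M.mulVec ξ ⬝ᵥ ξ) :
    (∀ v ξ : EuclideanSpace ℂ (Fin m), v ≠ 0 → 0 ≤ energyForm φ (complexOp M ξ) v ξ) ↔
      LambdaInftySq φ * (minEigenvalue M + maxEigenvalue M) ^ 2 ≤
        4 * (minEigenvalue M * maxEigenvalue M) := by
  have hH := isHermitian_of_isSymm hM
  obtain ⟨i, j, hi, hj⟩ := exists_eigenvalues_eq hH hm
  have hμ := eigenvalues_pos hH hpos i
  have hν := eigenvalues_pos hH hpos j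
  rw [hi] at hμ
  rw [hj] at hν
  set p := √(minEigenvalue M * maxEigenvalue M) with hp
  have hp0 : 0 < p := Real.sqrt_pos.2 (by positivity)
  have hp2 : p ^ 2 = minEigenvalue M * maxEigenvalue M := Real.sq_sqrt (by positivity)
  have h4 : 4 * (minEigenvalue M * maxEigenvalue M) = (2 * p) ^ 2 := by rw [mul_pow, hp2]; norm_num
  rw [h4, LambdaInftySq_mul_le_iff hφ (by positivity) (by positivity)]
  constructor
  · intro h s hs
    -- With a single eigenvalue there is no antieigenvector, but the condition is then just
    -- `AdmissibleWeight.abs_le`.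
    by_cases hne : minEigenvalue M = maxEigenvalue M
    · have : p = maxEigenvalue M := by
        rw [hp, hne]; exact Real.sqrt_mul_self hν.le
      rw [hne, this, ← two_mul]
      gcongr
      exact hφ.abs_le hs
    · obtain ⟨ξ, hξ1, hξ2, hξ3⟩ := exists_antieigenvector hH hm hpos hne
      have h1 := abs_mul_le_of_energyForm_nonneg hs hp0 (hφ.abs_le hs)
        (by rw [hξ2]; positivity) (by rw [hξ3, hp2]) (fun v hv => h v ξ hv)
      rw [hξ1, hξ2, ← hp2] at h1
      refine le_of_mul_le_mul_left ?_ hp0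
      linarith
  · intro h v ξ hv
    have hs : 0 < ‖v‖ := norm_pos_iff.2 hv
    refine energyForm_nonneg hv ?_
    have h1 := h _ hs
    have h2 := norm_complexOp_sq_le hH ξ
    rw [← hp2] at h2
    set S := minEigenvalue M + maxEigenvalue M
    have hS : 0 < S := by positivity
    set Y := inner ℝ (complexOp M ξ) ξ
    -- AM–GM: `2p|ξ||Mξ| ≤ p²|ξ|² + |Mξ|²`, and `h2` bounds the right side by `S * Y`.
    have h3 : 2 * p * (‖ξ‖ * ‖complexOp M ξ‖) ≤ S * Y := by
      nlinarith [sq_nonneg (p * ‖ξ‖ - ‖complexOp M ξ‖)]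
    have hY : 0 ≤ Y := by
      have : 0 ≤ S * Y := le_trans (by positivity) h3
      exact nonneg_of_mul_nonneg_right this hS
    have h5 := mul_le_mul_of_nonneg_left h3 (abs_nonneg (‖v‖ * deriv φ ‖v‖))
    have h6 := mul_le_mul_of_nonneg_right h1 hY
    refine le_of_mul_le_mul_left (a := 2 * p) ?_ (by positivity)
    linarith

/-! ### Differentiating `φ(|u|) u`. -/

section Pointwise

variable {V : Type*} [NormedAddCommGroup V] [InnerProductSpace ℝ V]

/-- The derivative of `φ(|u|) u` at a point where `u = v ≠ 0` and `u' = ξ`. -/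
def weightedDeriv (φ : ℝ → ℝ) (v ξ : V) : V :=
  φ ‖v‖ • ξ + (deriv φ ‖v‖ / ‖v‖ * inner ℝ v ξ) • v

theorem energyForm_eq_inner (φ : ℝ → ℝ) (η v ξ : V) :
    energyForm φ η v ξ = inner ℝ (weightedDeriv φ v ξ) η := by
  rw [real_inner_comm, energyForm, weightedDeriv, inner_add_right, inner_smul_right,
    inner_smul_right, mul_assoc]

theorem energyForm_smul_smul (φ : ℝ → ℝ) (c : ℝ) (η v ξ : V) :
    energyForm φ (c • η) v (c • ξ) = c ^ 2 * energyForm φ η v ξ := by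
  simp only [energyForm, inner_smul_left, inner_smul_right, conj_trivial]
  ring

theorem hasDerivAt_norm {u : ℝ → V} {u' : V} {x : ℝ} (hu : HasDerivAt u u' x) (h0 : u x ≠ 0) :
    HasDerivAt (fun y => ‖u y‖) (inner ℝ (u x) u' / ‖u x‖) x := by
  have h1 := hu.norm_sq.sqrt (by positivity)
  simp only [Real.sqrt_sq (norm_nonneg _)] at h1
  convert h1 using 1
  field_simp

theorem AdmissibleWeight.hasDerivAt_smul {φ : ℝ → ℝ} (h : AdmissibleWeight φ) {u : ℝ → V} {u' : V}
    {x : ℝ} (hu : HasDerivAt u u' x) (h0 : u x ≠ 0) :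
    HasDerivAt (fun y => φ ‖u y‖ • u y) (weightedDeriv φ (u x) u') x := by
  have h1 : HasDerivAt φ (deriv φ ‖u x‖) ‖u x‖ :=
    (h.differentiableAt (norm_pos_iff.2 h0)).hasDerivAt
  have h2 := (h1.comp x (hasDerivAt_norm hu h0)).smul hu
  have h3 : weightedDeriv φ (u x) u' =
      φ ‖u x‖ • u' + (deriv φ ‖u x‖ * (inner ℝ (u x) u' / ‖u x‖)) • u x := by
    rw [weightedDeriv]
    congr 2
    ring
  rw [h3]
  exact h2

theorem AdmissibleWeight.continuousOn_deriv {φ : ℝ → ℝ} (h : AdmissibleWeight φ) :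
    ContinuousOn (deriv φ) (Ioi 0) :=
  h.contDiffOn.continuousOn_deriv_of_isOpen isOpen_Ioi le_rfl

theorem AdmissibleWeight.continuousOn_weightedDeriv {φ : ℝ → ℝ} (h : AdmissibleWeight φ) :
    ContinuousOn (fun z : V × V => weightedDeriv φ z.1 z.2) {z | z.1 ≠ 0} := by
  have hn : ContinuousOn (fun z : V × V => ‖z.1‖) {z | z.1 ≠ 0} := by fun_prop
  have hmap : MapsTo (fun z : V × V => ‖z.1‖) {z | z.1 ≠ 0} (Ioi 0) :=
    fun z hz => norm_pos_iff.2 hz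
  refine ((h.contDiffOn.continuousOn.comp hn hmap).smul continuousOn_snd).add
    ((ContinuousOn.mul ((h.continuousOn_deriv.comp hn hmap).div hn fun z hz => ?_) ?_).smul
      continuousOn_fst)
  · exact (hmap hz).ne'
  · fun_prop

/-- Only zeros of `u` need care. If `u' = 0` there, the product vanishes; otherwise the zero is
isolated and the sign passes to the limit. The operator `T` stays frozen in that limit, so no
continuity of the coefficients is needed. -/
theorem AdmissibleWeight.inner_deriv_nonneg {φ : ℝ → ℝ} (h : AdmissibleWeight φ) (T : V →L[ℝ] V)
    (hT : ∀ v ξ : V, v ≠ 0 → 0 ≤ energyForm φ (T ξ) v ξ) {u : ℝ → V} (hu : ContDiff ℝ 1 u)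
    (hw : ContDiff ℝ 1 fun x => φ ‖u x‖ • u x) (x : ℝ) :
    0 ≤ inner ℝ (deriv (fun y => φ ‖u y‖ • u y) x) (T (deriv u x)) := by
  have hd : ∀ y, HasDerivAt u (deriv u y) y := fun y =>
    (hu.differentiable one_ne_zero y).hasDerivAt
  have hpt : ∀ y, u y ≠ 0 →
      0 ≤ inner ℝ (deriv (fun y => φ ‖u y‖ • u y) y) (T (deriv u y)) := by
    intro y hy
    rw [(h.hasDerivAt_smul (hd y) hy).deriv, ← energyForm_eq_inner]
    exact hT _ _ hy
  by_cases h0 : deriv u x = 0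
  · rw [h0, map_zero, inner_zero_right]
  have hcont : Continuous fun y => inner ℝ (deriv (fun y => φ ‖u y‖ • u y) y) (T (deriv u y)) :=
    (hw.continuous_deriv le_rfl).inner (T.continuous.comp (hu.continuous_deriv le_rfl))
  refine ge_of_tendsto (hcont.continuousAt.tendsto.mono_left
    (nhdsWithin_le_nhds (s := {x}ᶜ))) ?_
  filter_upwards [(hd x).eventually_ne (c := 0) h0] with y hy using hpt y hy

end Pointwise

/-! ### Integrability of the energy, and sufficiency. -/

section Integrability

variable {m : ℕ} {I : Set ℝ} {A : ℝ → Matrix (Fin m) (Fin m) ℝ}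

theorem integrableOn_inner_complexOp (hI : IsOpen I)
    (hA : ∀ i j, LocallyIntegrableOn (fun x => A x i j) I volume)
    {f g : ℝ → EuclideanSpace ℂ (Fin m)} (hf : Continuous f) (hg : Continuous g)
    (hfc : HasCompactSupport f) (hfI : tsupport f ⊆ I) :
    IntegrableOn (fun x => inner ℂ (f x) (complexOp (A x) (g x))) I := by
  have hexp : (fun x => inner ℂ (f x) (complexOp (A x) (g x))) = fun x =>
      ∑ i, ∑ j, (A x i j : ℂ) * (star (f x i) * g x j) := by
    ext x
    simp only [PiLp.inner_apply, complexOp, Matrix.ofLp_toEuclideanCLM, Matrix.mulVec, dotProduct,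
      Matrix.map_apply, RCLike.inner_apply, Finset.sum_mul]
    refine Finset.sum_congr rfl fun i _ => Finset.sum_congr rfl fun j _ => ?_
    rw [starRingEnd_apply]
    ring
  refine IntegrableOn.of_forall_sdiff_eq_zero (s := tsupport f) ?_ hI.measurableSet ?_
  · rw [hexp]
    refine integrable_finsetSum _ fun i _ => integrable_finsetSum _ fun j _ => ?_
    have h1 : IntegrableOn (fun x => (A x i j : ℂ)) (tsupport f) :=
      Integrable.ofReal ((hA i j).integrableOn_compact_subset hfI hfc.isCompact)
    refine h1.mul_continuousOn ?_ hfc.isCompact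
    have hfi : Continuous fun x => f x i := by fun_prop
    have hgj : Continuous fun x => g x j := by fun_prop
    exact (hfi.star.mul hgj).continuousOn
  · intro x hx
    rw [image_eq_zero_of_notMem_tsupport hx.2, inner_zero_left]

theorem integrableOn_complexOp (hA : ∀ i j, LocallyIntegrableOn (fun x => A x i j) I volume)
    {K : Set ℝ} (hK : IsCompact K) (hKI : K ⊆ I) (ξ : EuclideanSpace ℂ (Fin m)) :
    IntegrableOn (fun x => complexOp (A x) ξ) K := by
  have hexp : (fun x => complexOp (A x) ξ) = fun x =>
      ∑ i, ∑ j, (A x i j) • EuclideanSpace.single i (ξ j) := by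
    ext x k
    simp [complexOp, Matrix.mulVec, dotProduct, Pi.single_apply, Finset.sum_apply]
  rw [hexp]
  refine integrable_finsetSum _ fun i _ => integrable_finsetSum _ fun j _ => ?_
  exact Integrable.smul_const ((hA i j).integrableOn_compact_subset hKI hK) _

theorem lPhiDissipative_iff {φ : ℝ → ℝ} (hI : IsOpen I)
    (hA : ∀ i j, LocallyIntegrableOn (fun x => A x i j) I volume) :
    LPhiDissipative φ I (fun x => (A x).map Complex.ofReal) ↔
      ∀ u : ℝ → EuclideanSpace ℂ (Fin m), TestFunction I u →
        TestFunction I (fun x => φ ‖u x‖ • u x) →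
        0 ≤ ∫ x in I, inner ℝ (deriv (fun y => φ ‖u y‖ • u y) x)
          (complexOp (A x) (deriv u x)) := by
  refine forall_congr' fun u => forall_congr' fun hu => forall_congr' fun hw => ?_
  have h1 := integrableOn_inner_complexOp hI hA (hw.1.continuous_deriv le_rfl)
    (hu.1.continuous_deriv le_rfl) hw.2.1.deriv (tsupport_deriv_subset.trans hw.2.2)
  have h2 := integral_re h1
  simp only [RCLike.re_eq_complex_re, re_inner_complex] at h2
  rw [h2]

theorem lPhiDissipative_of_ae {φ : ℝ → ℝ} (hφ : AdmissibleWeight φ) (hI : IsOpen I)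
    (hA : ∀ i j, LocallyIntegrableOn (fun x => A x i j) I volume)
    (h : ∀ᵐ x ∂(volume.restrict I), ∀ v ξ : EuclideanSpace ℂ (Fin m), v ≠ 0 →
      0 ≤ energyForm φ (complexOp (A x) ξ) v ξ) :
    LPhiDissipative φ I (fun x => (A x).map Complex.ofReal) := by
  rw [lPhiDissipative_iff hI hA]
  intro u hu hw
  refine integral_nonneg_of_ae ?_
  filter_upwards [h] with x hx
  exact hφ.inner_deriv_nonneg ((complexOp (A x)).restrictScalars ℝ) hx hu.1 hw.1 x

end Integrability

theorem isOpen_openInterval (a b : EReal) : IsOpen (openInterval a b) :=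
  (isOpen_Ioo (a := a) (b := b)).preimage continuous_coe_real_ereal

/-! ### Admissible cutoffs. -/

section Plateau

theorem AdmissibleWeight.continuousAt_zero_ite {φ : ℝ → ℝ} (h : AdmissibleWeight φ) {s : ℝ}
    (hs : 0 < s) {k : ℕ} (hk : k ≠ 0) :
    ContinuousAt (fun y : ℝ => if 0 < y then s * y ^ k * φ (s * y ^ k) else 0) 0 := by
  rw [Metric.continuousAt_iff']
  intro ε hε
  -- The range condition supplies `σ` with `σφ(σ) = ε`; monotonicity makes `tφ(t) < ε` for `t < σ`.
  obtain ⟨σ, hσ, hσε⟩ : ε ∈ (fun s => s * φ s) '' Ioi 0 := by rw [h.range_eq]; exact hε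
  have hlim : ∀ᶠ y : ℝ in 𝓝 0, s * y ^ k < σ := by
    have : Tendsto (fun y : ℝ => s * y ^ k) (𝓝 0) (𝓝 (s * 0 ^ k)) :=
      (Continuous.tendsto (by fun_prop) _)
    rw [zero_pow hk, mul_zero] at this
    exact this.eventually_lt_const hσ
  filter_upwards [hlim] with y hy
  simp only [lt_irrefl, if_false, dist_zero_right]
  split_ifs with h0
  · have h1 : 0 < s * y ^ k := by positivity
    have h2 := h.strictMonoOn h1 hσ hy
    simp only at h2 hσε
    rw [Real.norm_of_nonneg (mul_pos h1 (h.pos _ h1)).le]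
    linarith
  · simpa using hε

/-- By the upper bound on `(sφ)'` near `0`, the derivative is `O(y^(k(r+1)-1))` as `y → 0⁺`. Since
`r > -1`, some `k` makes the exponent positive, so the derivative extends continuously by `0`. -/
theorem AdmissibleWeight.exists_contDiff_pow {φ : ℝ → ℝ} (h : AdmissibleWeight φ) {s : ℝ}
    (hs : 0 < s) : ∃ k : ℕ, k ≠ 0 ∧
      ContDiff ℝ 1 (fun y : ℝ => if 0 < y then s * y ^ k * φ (s * y ^ k) else 0) := by
  obtain ⟨r, s₀, C₁, C₂, hr, hs₀, hC₁, hC₂, hb, -, -⟩ := h.behaviour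
  obtain ⟨k, hk⟩ := exists_nat_gt (1 / (r + 1))
  have hr1 : 0 < r + 1 := by linarith
  rw [div_lt_iff₀ hr1] at hk
  have hk0 : k ≠ 0 := by rintro rfl; norm_num at hk
  set D : ℝ → ℝ := fun σ => φ σ + σ * deriv φ σ with hD
  have hDc : ContinuousOn D (Ioi 0) :=
    h.contDiffOn.continuousOn.add (continuousOn_id.mul h.continuousOn_deriv)
  set H : ℝ → ℝ := fun y => if 0 < y then s * y ^ k * φ (s * y ^ k) else 0 with hH
  set G : ℝ → ℝ := fun y => if 0 < y then D (s * y ^ k) * (s * (k * y ^ (k - 1))) else 0 with hG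
  have hpos : ∀ y ∈ Ioi (0 : ℝ), s * y ^ k ∈ Ioi (0 : ℝ) := fun y hy => by
    have : (0 : ℝ) < y := hy
    exact mem_Ioi.2 (by positivity)
  have hG0 : ContinuousAt G 0 := by
    have hp : 0 < k * (r + 1) - 1 := by linarith
    have hlim : Tendsto (fun y : ℝ => C₂ * (s ^ r * (s * k)) * |y| ^ (k * (r + 1) - 1)) (𝓝 0)
        (𝓝 0) := by
      have h1 : ContinuousAt (fun y : ℝ => C₂ * (s ^ r * (s * k)) * |y| ^ (k * (r + 1) - 1)) 0 :=
        continuousAt_const.mul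
          (continuous_abs.continuousAt.rpow_const (Or.inr hp.le))
      have h2 := h1.tendsto
      simp only [abs_zero, Real.zero_rpow hp.ne', mul_zero] at h2
      exact h2
    have hs0 : ∀ᶠ y : ℝ in 𝓝 0, s * y ^ k < s₀ := by
      have : Tendsto (fun y : ℝ => s * y ^ k) (𝓝 0) (𝓝 (s * 0 ^ k)) :=
        (Continuous.tendsto (by fun_prop) _)
      rw [zero_pow hk0, mul_zero] at this
      exact this.eventually_lt_const hs₀
    have h00 : G 0 = 0 := by simp [hG]
    rw [ContinuousAt, h00]
    refine squeeze_zero_norm' ?_ hlim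
    filter_upwards [hs0] with y hy
    simp only [hG]
    split_ifs with h0
    · have h1 : 0 < s * y ^ k := by positivity
      have h2 := (hb _ ⟨h1, hy⟩).2
      rw [(h.hasDerivAt_mul h1).deriv] at h2
      have h3 := h.add_pos h1
      rw [Real.norm_of_nonneg (by positivity), abs_of_pos h0]
      calc D (s * y ^ k) * (s * (k * y ^ (k - 1)))
          ≤ C₂ * (s * y ^ k) ^ r * (s * (k * y ^ (k - 1))) := by gcongr
        _ = C₂ * (s ^ r * (s * k)) * y ^ (k * (r + 1) - 1) := by
          rw [Real.mul_rpow hs.le (by positivity), ← Real.rpow_natCast_mul h0.le,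
            ← Real.rpow_natCast y (k - 1), Nat.cast_sub (Nat.one_le_iff_ne_zero.2 hk0),
            show (k : ℝ) * (r + 1) - 1 = k * r + (k - (1 : ℕ)) by push_cast; ring,
            Real.rpow_add h0]
          ring
    · rw [norm_zero]; positivity
  have hderiv : ∀ y, HasDerivAt H (G y) y := by
    refine hasDerivAt_of_hasDerivAt_of_ne' (x := 0) ?_
      (h.continuousAt_zero_ite hs hk0) hG0
    intro y hy
    rcases lt_or_gt_of_ne hy with hy | hy
    · have hH' : H =ᶠ[𝓝 y] fun _ => 0 := by
        filter_upwards [Iio_mem_nhds hy] with z hz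
        simp only [hH, if_neg (not_lt.2 (le_of_lt (mem_Iio.1 hz)))]
      simp only [hG, if_neg (not_lt.2 hy.le)]
      exact (hasDerivAt_const y 0).congr_of_eventuallyEq hH'
    · have hH' : H =ᶠ[𝓝 y] fun z => s * z ^ k * φ (s * z ^ k) := by
        filter_upwards [Ioi_mem_nhds hy] with z hz
        simp only [hH, if_pos (mem_Ioi.1 hz)]
      simp only [hG, if_pos hy]
      have h1 : HasDerivAt (fun z : ℝ => s * z ^ k) (s * (k * y ^ (k - 1))) y :=
        (hasDerivAt_pow k y).const_mul s
      have h2 := (h.hasDerivAt_mul (hpos y hy)).comp y h1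
      exact h2.congr_of_eventuallyEq hH'
  refine ⟨k, hk0, contDiff_one_iff_deriv.2 ⟨fun y => (hderiv y).differentiableAt, ?_⟩⟩
  have hHG : deriv H = G := funext fun y => (hderiv y).deriv
  rw [hHG, continuous_iff_continuousAt]
  intro y
  rcases lt_trichotomy y 0 with hy | rfl | hy
  · have hG' : G =ᶠ[𝓝 y] fun _ => 0 := by
      filter_upwards [Iio_mem_nhds hy] with z hz
      simp only [hG, if_neg (not_lt.2 (le_of_lt (mem_Iio.1 hz)))]
    exact continuousAt_const.congr hG'.symm
  · exact hG0
  · have hG' : G =ᶠ[𝓝 y] fun z => D (s * z ^ k) * (s * (k * z ^ (k - 1))) := by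
      filter_upwards [Ioi_mem_nhds hy] with z hz
      simp only [hG, if_pos (mem_Ioi.1 hz)]
    refine ContinuousAt.congr ?_ hG'.symm
    have h1 : ContinuousAt D (s * y ^ k) := hDc.continuousAt (Ioi_mem_nhds (hpos y hy))
    have h2 : ContinuousAt (fun z : ℝ => s * z ^ k) y := by fun_prop
    exact (ContinuousAt.comp (f := fun z : ℝ => s * z ^ k) h1 h2).mul (by fun_prop)

theorem exists_contDiff_bump {K I : Set ℝ} (hK : IsCompact K) (hI : IsOpen I) (hKI : K ⊆ I) :
    ∃ ρ : ℝ → ℝ, ContDiff ℝ 1 ρ ∧ HasCompactSupport ρ ∧ tsupport ρ ⊆ I ∧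
      (∀ᶠ x in 𝓝ˢ K, ρ x = 1) ∧ ∀ x, ρ x ∈ Icc 0 1 := by
  obtain ⟨L, hL, hKL, hLI⟩ := exists_compact_between hK hI hKI
  obtain ⟨ρ, h1, h0, h01⟩ := exists_contMDiffMap_one_nhds_of_subset_interior
    (modelWithCornersSelf ℝ ℝ) (n := 1) hK.isClosed hKL
  have hts : tsupport ρ ⊆ L := closure_minimal (fun x hx => by
    by_contra hxL; exact hx (h0 x hxL)) hL.isClosed
  exact ⟨ρ, ρ.contMDiff.contDiff, hL.of_isClosed_subset (isClosed_tsupport _) hts,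
    hts.trans hLI, h1, h01⟩

/-- A power of a smooth bump vanishes fast enough at the edge of its support to compensate for a
possible singularity of `φ` at `0`. -/
theorem AdmissibleWeight.exists_plateau {φ : ℝ → ℝ} (h : AdmissibleWeight φ) {V : Type*}
    [NormedAddCommGroup V] [InnerProductSpace ℝ V] {v : V} (hv : v ≠ 0) {K I : Set ℝ}
    (hK : IsCompact K) (hI : IsOpen I) (hKI : K ⊆ I) :
    ∃ g : ℝ → ℝ, ContDiff ℝ 1 g ∧ HasCompactSupport g ∧ tsupport g ⊆ I ∧
      (∀ᶠ x in 𝓝ˢ K, g x = 1) ∧ ContDiff ℝ 1 (fun x => φ ‖g x • v‖ • (g x • v)) := by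
  have hs : 0 < ‖v‖ := norm_pos_iff.2 hv
  obtain ⟨ρ, hρ, hρc, hρI, hρ1, hρ01⟩ := exists_contDiff_bump hK hI hKI
  obtain ⟨k, hk, hH⟩ := h.exists_contDiff_pow hs
  have hsupp : Function.support (fun x => ρ x ^ k) = Function.support ρ := by
    ext x; simp [hk]
  refine ⟨fun x => ρ x ^ k, hρ.pow k, ?_, ?_, ?_, ?_⟩
  · rw [HasCompactSupport, tsupport, hsupp]; exact hρc
  · rw [tsupport, hsupp]; exact hρI
  · filter_upwards [hρ1] with x hx
    rw [hx, one_pow]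
  · have heq : (fun x => φ ‖ρ x ^ k • v‖ • (ρ x ^ k • v)) = fun x =>
        (if 0 < ρ x then ‖v‖ * ρ x ^ k * φ (‖v‖ * ρ x ^ k) else 0) • ((‖v‖)⁻¹ • v) := by
      ext1 x
      split_ifs with h0
      · rw [norm_smul, Real.norm_of_nonneg (by positivity), smul_smul, smul_smul,
          mul_comm (ρ x ^ k) ‖v‖]
        congr 1
        field_simp
      · have : ρ x = 0 := le_antisymm (not_lt.1 h0) (hρ01 x).1
        simp [this, hk]
    rw [heq]
    exact (hH.comp hρ).smul contDiff_const

end Plateau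

/-! ### Perturbing a plateau. -/

section Perturbation

variable {m : ℕ} {I : Set ℝ} {A : ℝ → Matrix (Fin m) (Fin m) ℝ}

theorem TestFunction.integrableOn_inner {u w : ℝ → EuclideanSpace ℂ (Fin m)} (hI : IsOpen I)
    (hA : ∀ i j, LocallyIntegrableOn (fun x => A x i j) I volume) (hu : TestFunction I u)
    (hw : TestFunction I w) :
    IntegrableOn (fun x => inner ℝ (deriv w x) (complexOp (A x) (deriv u x))) I := by
  have h1 := (integrableOn_inner_complexOp hI hA (hw.1.continuous_deriv le_rfl)
    (hu.1.continuous_deriv le_rfl) hw.2.1.deriv (tsupport_deriv_subset.trans hw.2.2)).re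
  simp only [RCLike.re_eq_complex_re, re_inner_complex] at h1
  exact h1

theorem TestFunction.weighted {φ : ℝ → ℝ} {u : ℝ → EuclideanSpace ℂ (Fin m)}
    (hu : TestFunction I u) (hw : ContDiff ℝ 1 fun x => φ ‖u x‖ • u x) :
    TestFunction I fun x => φ ‖u x‖ • u x := by
  have hsub : tsupport (fun x => φ ‖u x‖ • u x) ⊆ tsupport u :=
    closure_mono fun x hx h0 => hx (by simp [h0])
  exact ⟨hw, hu.2.1.of_isClosed_subset (isClosed_tsupport _) hsub, hsub.trans hu.2.2⟩

/-- On `K` the plateau is locally constant, and off `K` the perturbation vanishes, so no cross terms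
appear; `C` is the energy of the plateau alone. The bound on `β` keeps `v + βξ` away from `0`. -/
theorem LPhiDissipative.exists_add_integral_nonneg {φ : ℝ → ℝ} (hφ : AdmissibleWeight φ)
    (hI : IsOpen I) (hA : ∀ i j, LocallyIntegrableOn (fun x => A x i j) I volume)
    (hdiss : LPhiDissipative φ I (fun x => (A x).map Complex.ofReal)) {K : Set ℝ}
    (hK : IsCompact K) (hKI : K ⊆ I) {v : EuclideanSpace ℂ (Fin m)} (hv : v ≠ 0)
    (ξ : EuclideanSpace ℂ (Fin m)) :
    ∃ C : ℝ, ∀ β : ℝ → ℝ, ContDiff ℝ 1 β → tsupport β ⊆ K → (∀ x, |β x| * ‖ξ‖ < ‖v‖) →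
      0 ≤ C + ∫ x in I, deriv β x ^ 2 *
        energyForm φ (complexOp (A x) ξ) (v + β x • ξ) ξ := by
  rw [lPhiDissipative_iff hI hA] at hdiss
  obtain ⟨g, hg, hgc, hgI, hg1, hgw⟩ := hφ.exists_plateau hv hK hI hKI
  have hu₀ : TestFunction I (fun x => g x • v) :=
    ⟨hg.smul contDiff_const, hgc.smul_right,
      (closure_mono (Function.support_smul_subset_left _ _)).trans hgI⟩
  have hw₀ := hu₀.weighted hgw
  refine ⟨∫ x in I, inner ℝ (deriv (fun y => φ ‖g y • v‖ • (g y • v)) x)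
    (complexOp (A x) (deriv (fun y => g y • v) x)), fun β hβ hβK hβv => ?_⟩
  have hβc : HasCompactSupport β := hK.of_isClosed_subset (isClosed_tsupport _) hβK
  set u : ℝ → EuclideanSpace ℂ (Fin m) := fun x => g x • v + β x • ξ with hu_def
  have hne : ∀ x, v + β x • ξ ≠ 0 := by
    intro x hx
    have h1 : ‖v‖ = ‖β x • ξ‖ := by rw [eq_neg_of_add_eq_zero_left hx, norm_neg]
    rw [norm_smul, Real.norm_eq_abs] at h1
    exact (hβv x).ne h1.symm
  have hgnear : ∀ x ∈ K, ∀ᶠ y in 𝓝 x, g y = 1 := eventually_nhdsSet_iff_forall.1 hg1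
  have hβnear : ∀ x ∉ K, ∀ᶠ y in 𝓝 x, β y = 0 := by
    intro x hx
    filter_upwards [hK.isClosed.isOpen_compl.mem_nhds hx] with y hy
    exact image_eq_zero_of_notMem_tsupport fun h => hy (hβK h)
  have hu1 : ContDiff ℝ 1 u := (hg.smul contDiff_const).add (hβ.smul contDiff_const)
  have hu : TestFunction I u := by
    have hβξ : HasCompactSupport (fun x => β x • ξ) := hβc.smul_right
    refine ⟨hu1, hu₀.2.1.add hβξ, (tsupport_add _ _).trans (union_subset hu₀.2.2 ?_)⟩
    exact (closure_mono (Function.support_smul_subset_left _ _)).trans (hβK.trans hKI)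
  have huK : ∀ x ∈ K, u =ᶠ[𝓝 x] fun y => v + β y • ξ := by
    intro x hx
    filter_upwards [hgnear x hx] with y hy
    simp [hu_def, hy]
  have hunK : ∀ x ∉ K, u =ᶠ[𝓝 x] fun y => g y • v := by
    intro x hx
    filter_upwards [hβnear x hx] with y hy
    simp [hu_def, hy]
  have huKne : ∀ x ∈ K, u x ≠ 0 := fun x hx => by rw [(huK x hx).eq_of_nhds]; exact hne x
  have hw1 : ContDiff ℝ 1 fun x => φ ‖u x‖ • u x := by
    rw [contDiff_iff_contDiffAt]
    intro x
    by_cases hx : x ∈ K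
    · have hpos : 0 < ‖u x‖ := norm_pos_iff.2 (huKne x hx)
      have h1 : ContDiffAt ℝ 1 (fun y => ‖u y‖) x := hu1.contDiffAt.norm ℝ (huKne x hx)
      have h2 : ContDiffAt ℝ 1 φ ‖u x‖ := hφ.contDiffOn.contDiffAt (Ioi_mem_nhds hpos)
      exact (ContDiffAt.comp (f := fun y => ‖u y‖) x h2 h1).smul hu1.contDiffAt
    · refine hgw.contDiffAt.congr_of_eventuallyEq ?_
      filter_upwards [hunK x hx] with y hy
      rw [hy]
  have hw := hu.weighted hw1
  have hpt : ∀ x, deriv β x ^ 2 * energyForm φ (complexOp (A x) ξ) (v + β x • ξ) ξ =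
      inner ℝ (deriv (fun y => φ ‖u y‖ • u y) x) (complexOp (A x) (deriv u x)) -
      inner ℝ (deriv (fun y => φ ‖g y • v‖ • (g y • v)) x)
        (complexOp (A x) (deriv (fun y => g y • v) x)) := by
    intro x
    by_cases hx : x ∈ K
    · have h1 : deriv (fun y => g y • v) x = 0 := by
        have : (fun y => g y • v) =ᶠ[𝓝 x] fun _ => v := by
          filter_upwards [hgnear x hx] with y hy
          rw [hy, one_smul]
        rw [this.deriv_eq, deriv_const]
      have h2 : HasDerivAt u (deriv β x • ξ) x := by
        refine HasDerivAt.congr_of_eventuallyEq ?_ (huK x hx)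
        exact (((hβ.differentiable one_ne_zero x).hasDerivAt).smul_const ξ).const_add v
      rw [h1, map_zero, inner_zero_right, sub_zero,
        (hφ.hasDerivAt_smul h2 (huKne x hx)).deriv, h2.deriv, ← energyForm_eq_inner,
        ContinuousLinearMap.map_smul_of_tower, energyForm_smul_smul, (huK x hx).eq_of_nhds]
    · have h1 : deriv β x = 0 := by
        have : β =ᶠ[𝓝 x] fun _ => 0 := hβnear x hx
        rw [this.deriv_eq, deriv_const]
      have h2 : (fun y => φ ‖u y‖ • u y) =ᶠ[𝓝 x] fun y => φ ‖g y • v‖ • (g y • v) := by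
        filter_upwards [hunK x hx] with y hy
        rw [hy]
      rw [h1, h2.deriv_eq, (hunK x hx).deriv_eq]
      simp
  simp_rw [hpt]
  rw [integral_sub (hu.integrableOn_inner hI hA hw) (hu₀.integrableOn_inner hI hA hw₀)]
  have := hdiss u hu hw
  linarith

end Perturbation

/-! ### Oscillating perturbations, and pointwise signs from integrals. -/

section Localization

theorem hasDerivAt_oscillation {η : ℝ → ℝ} (hη : ContDiff ℝ 1 η) (M N x : ℝ) (hN : N ≠ 0) :
    HasDerivAt (fun y => M / N * (Real.sin (N * y) * η y))
      (M * (Real.cos (N * x) * η x + Real.sin (N * x) * deriv η x / N)) x ∧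
    HasDerivAt (fun y => M / N * (Real.cos (N * y) * η y))
      (M * (-Real.sin (N * x) * η x + Real.cos (N * x) * deriv η x / N)) x := by
  have hη' := (hη.differentiable one_ne_zero x).hasDerivAt
  have hl : HasDerivAt (fun y : ℝ => N * y) N x := by
    simpa using (hasDerivAt_id' x).const_mul N
  constructor
  · refine ((hl.sin.fun_mul hη').const_mul (M / N)).congr_deriv ?_
    field_simp
  · refine ((hl.cos.fun_mul hη').const_mul (M / N)).congr_deriv ?_
    field_simp

theorem nonneg_of_forall_add_sq_mul_nonneg {C D : ℝ} (h : ∀ M : ℝ, 0 ≤ C + M ^ 2 * D) :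
    0 ≤ D := by
  by_contra! hD
  have h1 := h √((|C| + 1) / (-D))
  rw [Real.sq_sqrt (div_nonneg (by positivity) (by linarith))] at h1
  have h2 : (|C| + 1) / (-D) * D = -(|C| + 1) := by
    have : D ≠ 0 := hD.ne
    field_simp
  rw [h2] at h1
  linarith [le_abs_self C]

/-- Rapidly oscillating perturbations of fixed slope and vanishing amplitude turn a lower bound on
`∫ (β')² f(x, β)` into a bound on `∫ η² f(x, 0)`. -/
theorem setIntegral_sq_mul_nonneg {K : Set ℝ} (hK : IsCompact K) {f : ℝ → ℝ → ℝ} {B : ℝ → ℝ}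
    {δ C : ℝ} (hδ : 0 < δ) (hB : IntegrableOn B K)
    (hmeas : ∀ β : ℝ → ℝ, Continuous β → (∀ x, |β x| ≤ δ) →
      AEStronglyMeasurable (fun x => f x (β x)) (volume.restrict K))
    (hbound : ∀ x t, |t| ≤ δ → |f x t| ≤ B x) (hcont : ∀ x, ContinuousAt (f x) 0)
    (H : ∀ β : ℝ → ℝ, ContDiff ℝ 1 β → tsupport β ⊆ K → (∀ x, |β x| ≤ δ) →
      0 ≤ C + ∫ x in K, deriv β x ^ 2 * f x (β x))
    {η : ℝ → ℝ} (hη : ContDiff ℝ 1 η) (hηK : tsupport η ⊆ K) :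
    0 ≤ ∫ x in K, η x ^ 2 * f x 0 := by
  have hηc : HasCompactSupport η := hK.of_isClosed_subset (isClosed_tsupport _) hηK
  obtain ⟨S, hS⟩ := hηc.exists_bound_of_continuous hη.continuous
  obtain ⟨S', hS'⟩ := hηc.deriv.exists_bound_of_continuous (hη.continuous_deriv le_rfl)
  simp only [Real.norm_eq_abs] at hS hS'
  have hS0 : 0 ≤ S := (abs_nonneg _).trans (hS 0)
  -- The constant doubles because the inequalities for a sine and a cosine perturbation are added.
  refine nonneg_of_forall_add_sq_mul_nonneg (C := 2 * C) fun M => ?_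
  set N : ℕ → ℝ := fun n => n + 1 with hN
  have hN1 : ∀ n, 1 ≤ N n := fun n => by simp [hN]
  have hN0 : ∀ n, N n ≠ 0 := fun n => (zero_lt_one.trans_le (hN1 n)).ne'
  have hNinv : Tendsto (fun n => M / N n) atTop (𝓝 0) :=
    tendsto_const_nhds.div_atTop (tendsto_natCast_atTop_atTop.atTop_add tendsto_const_nhds)
  set p : ℕ → ℝ → ℝ := fun n y => M / N n * (Real.sin (N n * y) * η y) with hp
  set q : ℕ → ℝ → ℝ := fun n y => M / N n * (Real.cos (N n * y) * η y) with hq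
  have hp1 : ∀ n, ContDiff ℝ 1 (p n) := fun n => by
    simp only [hp]; fun_prop
  have hq1 : ∀ n, ContDiff ℝ 1 (q n) := fun n => by
    simp only [hq]; fun_prop
  have hpd := fun n x => (hasDerivAt_oscillation hη M (N n) x (hN0 n)).1.deriv
  have hqd := fun n x => (hasDerivAt_oscillation hη M (N n) x (hN0 n)).2.deriv
  have hpK : ∀ n, tsupport (p n) ⊆ K := fun n =>
    (closure_mono fun x (hx : p n x ≠ 0) (h0 : η x = 0) => hx (by simp [hp, h0])).trans hηK
  have hqK : ∀ n, tsupport (q n) ⊆ K := fun n =>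
    (closure_mono fun x (hx : q n x ≠ 0) (h0 : η x = 0) => hx (by simp [hq, h0])).trans hηK
  have hle : ∀ (n : ℕ) (t y : ℝ), |t| ≤ 1 → |M / N n * (t * η y)| ≤ |M / N n| * S := by
    intro n t y ht
    rw [abs_mul, abs_mul]
    gcongr
    calc |t| * |η y| ≤ 1 * S := by gcongr; exact hS y
      _ = S := one_mul S
  have hple : ∀ n y, |p n y| ≤ |M / N n| * S := fun n y => hle n _ y (Real.abs_sin_le_one _)
  have hqle : ∀ n y, |q n y| ≤ |M / N n| * S := fun n y => hle n _ y (Real.abs_cos_le_one _)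
  have hsmall : ∀ᶠ n in atTop, |M / N n| * S ≤ δ := by
    have h1 : Tendsto (fun n => |M / N n| * S) atTop (𝓝 (|0| * S)) := hNinv.abs.mul_const S
    rw [abs_zero, zero_mul] at h1
    exact (h1.eventually_lt_const hδ).mono fun n hn => hn.le
  set R : ℝ := |M| * (S + S') with hR
  have hslope : ∀ (n : ℕ) (s t x : ℝ), |s| ≤ 1 → |t| ≤ 1 →
      |M * (s * η x + t * deriv η x / N n)| ≤ R := by
    intro n s t x hs ht
    rw [abs_mul]
    refine mul_le_mul_of_nonneg_left ((abs_add_le _ _).trans (add_le_add ?_ ?_)) (abs_nonneg _)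
    · rw [abs_mul]
      exact (mul_le_of_le_one_left (abs_nonneg _) hs).trans (hS x)
    · rw [abs_div, abs_mul, abs_of_pos (zero_lt_one.trans_le (hN1 n))]
      exact (div_le_self (by positivity) (hN1 n)).trans
        ((mul_le_of_le_one_left (abs_nonneg _) ht).trans (hS' x))
  have hpR : ∀ n x, |deriv (p n) x| ≤ R := fun n x => by
    rw [hpd]; exact hslope n _ _ x (Real.abs_cos_le_one _) (Real.abs_sin_le_one _)
  have hqR : ∀ n x, |deriv (q n) x| ≤ R := fun n x => by
    rw [hqd]
    exact hslope n _ _ x (by rw [abs_neg]; exact Real.abs_sin_le_one _) (Real.abs_cos_le_one _)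
  -- Pairing sine with cosine makes the squared slopes add up without oscillation, so dominated
  -- convergence suffices and no weak limit is needed.
  have hsum : ∀ n x, deriv (p n) x ^ 2 + deriv (q n) x ^ 2 =
      M ^ 2 * (η x ^ 2 + (deriv η x / N n) ^ 2) := by
    intro n x
    rw [hpd, hqd]
    have := Real.sin_sq_add_cos_sq (N n * x)
    linear_combination M ^ 2 * (η x ^ 2 + (deriv η x / N n) ^ 2) * this
  have hterm : ∀ β : ℝ → ℝ, ContDiff ℝ 1 β → (∀ x, |β x| ≤ δ) → (∀ x, |deriv β x| ≤ R) →
      IntegrableOn (fun x => deriv β x ^ 2 * f x (β x)) K ∧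
      ∀ x, ‖deriv β x ^ 2 * f x (β x)‖ ≤ R ^ 2 * B x := by
    intro β hβ hβδ hβR
    have hb : ∀ x, ‖deriv β x ^ 2 * f x (β x)‖ ≤ R ^ 2 * B x := by
      intro x
      rw [norm_mul, Real.norm_eq_abs, Real.norm_eq_abs, abs_pow]
      exact mul_le_mul (pow_le_pow_left₀ (abs_nonneg _) (hβR x) 2) (hbound x _ (hβδ x))
        (abs_nonneg _) (sq_nonneg R)
    refine ⟨Integrable.mono' (hB.const_mul (R ^ 2)) ?_ (ae_of_all _ hb), hb⟩
    exact ((hβ.continuous_deriv le_rfl).pow 2).aestronglyMeasurable.mul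
      (hmeas β hβ.continuous hβδ)
  set F : ℕ → ℝ → ℝ := fun n x =>
    deriv (p n) x ^ 2 * f x (p n x) + deriv (q n) x ^ 2 * f x (q n x) with hF
  have hgood : ∀ᶠ n in atTop, (∀ x, |p n x| ≤ δ) ∧ ∀ x, |q n x| ≤ δ := by
    filter_upwards [hsmall] with n hn
    exact ⟨fun x => (hple n x).trans hn, fun x => (hqle n x).trans hn⟩
  have hFpos : ∀ᶠ n in atTop, 0 ≤ 2 * C + ∫ x in K, F n x := by
    filter_upwards [hgood] with n hn
    rw [hF]
    simp only
    rw [integral_add (hterm _ (hp1 n) hn.1 (hpR n)).1 (hterm _ (hq1 n) hn.2 (hqR n)).1]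
    have h1 := H _ (hp1 n) (hpK n) hn.1
    have h2 := H _ (hq1 n) (hqK n) hn.2
    linarith
  have hzero : ∀ (b c : ℕ → ℝ) (x : ℝ), (∀ n, |b n| ≤ |M / N n| * S) → (∀ n, |c n| ≤ R) →
      Tendsto (fun n => c n ^ 2 * (f x (b n) - f x 0)) atTop (𝓝 0) := by
    intro b c x hb hc
    have hb0 : Tendsto b atTop (𝓝 0) := by
      refine squeeze_zero_norm hb ?_
      have := hNinv.abs.mul_const S
      simpa using this
    have h1 : Tendsto (fun n => R ^ 2 * |f x (b n) - f x 0|) atTop (𝓝 0) := by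
      have := ((((hcont x).tendsto.comp hb0).sub_const (f x 0)).abs).const_mul (R ^ 2)
      simpa using this
    refine squeeze_zero_norm (fun n => ?_) h1
    rw [norm_mul, Real.norm_eq_abs, Real.norm_eq_abs, abs_pow]
    gcongr
    exact hc n
  have hlim : Tendsto (fun n => ∫ x in K, F n x) atTop
      (𝓝 (∫ x in K, M ^ 2 * (η x ^ 2 * f x 0))) := by
    refine tendsto_integral_filter_of_dominated_convergence
      (fun x => R ^ 2 * B x + R ^ 2 * B x) ?_ ?_ ?_ ?_
    · filter_upwards [hgood] with n hn
      exact ((hterm _ (hp1 n) hn.1 (hpR n)).1.add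
        (hterm _ (hq1 n) hn.2 (hqR n)).1).aestronglyMeasurable
    · filter_upwards [hgood] with n hn
      refine ae_of_all _ fun x => (norm_add_le _ _).trans (add_le_add ?_ ?_)
      · exact (hterm _ (hp1 n) hn.1 (hpR n)).2 x
      · exact (hterm _ (hq1 n) hn.2 (hqR n)).2 x
    · exact (hB.const_mul (R ^ 2)).add (hB.const_mul (R ^ 2))
    · refine ae_of_all _ fun x => ?_
      have h1 := hzero (fun n => p n x) (fun n => deriv (p n) x) x (fun n => hple n x)
        fun n => hpR n x
      have h2 := hzero (fun n => q n x) (fun n => deriv (q n) x) x (fun n => hqle n x)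
        fun n => hqR n x
      have h3 : Tendsto (fun n => M ^ 2 * (η x ^ 2 + (deriv η x / N n) ^ 2) * f x 0) atTop
          (𝓝 (M ^ 2 * (η x ^ 2 + 0) * f x 0)) := by
        refine ((tendsto_const_nhds.add ?_).const_mul _).mul_const _
        have : Tendsto (fun n => deriv η x / N n) atTop (𝓝 0) :=
          tendsto_const_nhds.div_atTop (tendsto_natCast_atTop_atTop.atTop_add tendsto_const_nhds)
        simpa using this.pow 2
      have h4 := (h1.add h2).add h3
      convert h4 using 2
      · rename_i n
        rw [← hsum]
        simp only [hF]
        ring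
      · ring
  have := ge_of_tendsto (hlim.const_add (2 * C)) hFpos
  rwa [integral_const_mul] at this

/-- Squared bumps equal to `1` on `K` and supported in shrinking neighbourhoods converge pointwise
to the indicator of `K`. -/
theorem setIntegral_nonneg_of_integral_sq_mul_nonneg {I : Set ℝ} (hI : IsOpen I) {f : ℝ → ℝ}
    (hf : LocallyIntegrableOn f I)
    (h : ∀ η : ℝ → ℝ, ContDiff ℝ 1 η → HasCompactSupport η → tsupport η ⊆ I →
      0 ≤ ∫ x in I, η x ^ 2 * f x) {K : Set ℝ} (hK : IsCompact K) (hKI : K ⊆ I) :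
    0 ≤ ∫ x in K, f x := by
  obtain ⟨δ, hδ, hδI⟩ := hK.exists_cthickening_subset_open hI hKI
  set L := Metric.cthickening δ K with hL
  have hLc : IsCompact L := hK.cthickening
  have hfL : IntegrableOn f L := hf.integrableOn_compact_subset hδI hLc
  obtain ⟨u, -, hu, hu0⟩ := exists_seq_strictAnti_tendsto' hδ
  choose ρ hρ hρc hρI hρ1 hρ01 using fun n => exists_contDiff_bump hK
    (Metric.isOpen_thickening (δ := u n)) (Metric.self_subset_thickening (hu n).1 K)
  have hρL : ∀ n, tsupport (ρ n) ⊆ L := fun n =>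
    (hρI n).trans (Metric.thickening_subset_cthickening_of_le (hu n).2.le _)
  have hpos : ∀ n, 0 ≤ ∫ x in L, ρ n x ^ 2 * f x := by
    intro n
    rw [← setIntegral_eq_of_subset_of_forall_sdiff_eq_zero hI.measurableSet hδI fun x hx => by
      rw [image_eq_zero_of_notMem_tsupport fun h => hx.2 (hρL n h)]; simp]
    exact h _ (hρ n) (hρc n) ((hρL n).trans hδI)
  have hlim : Tendsto (fun n => ∫ x in L, ρ n x ^ 2 * f x) atTop
      (𝓝 (∫ x in L, K.indicator f x)) := by
    refine tendsto_integral_of_dominated_convergence (fun x => ‖f x‖) (fun n => ?_) hfL.norm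
      (fun n => ?_) ?_
    · exact ((hρ n).continuous.pow 2).aestronglyMeasurable.mul hfL.aestronglyMeasurable
    · refine ae_of_all _ fun x => ?_
      have h1 := hρ01 n x
      rw [norm_mul, Real.norm_of_nonneg (sq_nonneg _)]
      exact mul_le_of_le_one_left (norm_nonneg _) (pow_le_one₀ h1.1 h1.2)
    · refine ae_of_all _ fun x => ?_
      by_cases hx : x ∈ K
      · have : ∀ n, ρ n x = 1 := fun n => (hρ1 n).self_of_nhdsSet x hx
        simp [this, hx]
      · rw [indicator_of_notMem hx]
        refine tendsto_const_nhds.congr' ?_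
        obtain ⟨ε, hε, hxε⟩ : ∃ ε, 0 < ε ∧ x ∉ Metric.thickening ε K := by
          rw [← hK.isClosed.closure_eq, Metric.closure_eq_iInter_thickening K] at hx
          simpa using hx
        filter_upwards [hu0.eventually_lt_const hε] with n hn
        rw [image_eq_zero_of_notMem_tsupport fun hmem =>
          hxε (Metric.thickening_mono hn.le K (hρI n hmem))]
        simp
  have h1 := ge_of_tendsto' hlim hpos
  rwa [setIntegral_indicator hK.measurableSet,
    inter_eq_right.2 (Metric.self_subset_cthickening K)] at h1

theorem ae_nonneg_of_integral_sq_mul_nonneg {I : Set ℝ} (hI : IsOpen I) {f : ℝ → ℝ}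
    (hf : LocallyIntegrableOn f I)
    (h : ∀ η : ℝ → ℝ, ContDiff ℝ 1 η → HasCompactSupport η → tsupport η ⊆ I →
      0 ≤ ∫ x in I, η x ^ 2 * f x) : ∀ᵐ x ∂(volume.restrict I), 0 ≤ f x := by
  have hm : AEStronglyMeasurable f (volume.restrict I) := hf.aestronglyMeasurable
  set g := hm.mk f with hg
  have hgm : Measurable g := hm.stronglyMeasurable_mk.measurable
  have hS : MeasurableSet (I ∩ {x | g x < 0}) :=
    hI.measurableSet.inter (measurableSet_lt hgm measurable_const)
  have hnull : volume (I ∩ {x | g x < 0}) = 0 := by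
    by_contra hne
    -- By inner regularity a nonnull negativity set contains a compact set of positive measure,
    -- where the integral would be negative.
    obtain ⟨K, hKS, hK, hKpos⟩ := hS.exists_lt_isCompact (pos_iff_ne_zero.2 hne)
    have hKI : K ⊆ I := hKS.trans inter_subset_left
    have hfg : f =ᵐ[volume.restrict K] g :=
      ae_restrict_of_ae_restrict_of_subset hKI hm.ae_eq_mk
    have hgK : IntegrableOn g K := (hf.integrableOn_compact_subset hKI hK).congr hfg
    have h0 := setIntegral_nonneg_of_integral_sq_mul_nonneg hI hf h hK hKI
    rw [integral_congr_ae hfg] at h0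
    have hneg : ∀ᵐ x ∂(volume.restrict K), g x < 0 :=
      ae_restrict_of_forall_mem hK.measurableSet fun x hx => (hKS hx).2
    have h1 : 0 ≤ᵐ[volume.restrict K] fun x => -g x := hneg.mono fun x hx => by
      simpa using hx.le
    have h2 : ∫ x in K, -g x = 0 := le_antisymm (by rw [integral_neg]; linarith)
      (integral_nonneg_of_ae h1)
    rw [integral_eq_zero_iff_of_nonneg_ae h1 hgK.neg] at h2
    have h3 : ∀ᵐ x ∂(volume.restrict K), False := by
      filter_upwards [hneg, h2] with x hx hx2
      simp only [Pi.zero_apply] at hx2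
      linarith
    rw [eventually_false_iff_eq_bot, ae_eq_bot, Measure.restrict_eq_zero] at h3
    exact hKpos.ne' h3
  have h4 : ∀ᵐ x ∂(volume.restrict I), 0 ≤ g x := by
    rw [ae_restrict_iff' hI.measurableSet, ae_iff]
    refine measure_mono_null (fun x hx => ?_) hnull
    simp only [mem_ofPred_eq, Classical.not_imp, not_le] at hx
    exact hx
  filter_upwards [h4, hm.ae_eq_mk] with x hx hx2
  rw [hx2]
  exact hx

end Localization

/-! ### Necessity of the pointwise inequality. -/

section Necessity

variable {m : ℕ} {I : Set ℝ} {A : ℝ → Matrix (Fin m) (Fin m) ℝ}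

theorem LPhiDissipative.ae_energyForm_nonneg {φ : ℝ → ℝ} (hφ : AdmissibleWeight φ)
    (hI : IsOpen I) (hA : ∀ i j, LocallyIntegrableOn (fun x => A x i j) I volume)
    (hdiss : LPhiDissipative φ I (fun x => (A x).map Complex.ofReal))
    {v : EuclideanSpace ℂ (Fin m)} (hv : v ≠ 0) (ξ : EuclideanSpace ℂ (Fin m)) :
    ∀ᵐ x ∂(volume.restrict I), 0 ≤ energyForm φ (complexOp (A x) ξ) v ξ := by
  have hloc : LocallyIntegrableOn (fun x => energyForm φ (complexOp (A x) ξ) v ξ) I := by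
    rw [locallyIntegrableOn_iff hI.isLocallyClosed]
    intro K hKI hK
    simp_rw [energyForm_eq_inner]
    exact (integrableOn_complexOp hA hK hKI ξ).const_inner _
  refine ae_nonneg_of_integral_sq_mul_nonneg hI hloc fun η hη hηc hηI => ?_
  set K := tsupport η with hKdef
  have hK : IsCompact K := hηc.isCompact
  have hv0 : 0 < ‖v‖ := norm_pos_iff.2 hv
  -- For `|t| ≤ δ` the vector `v + tξ` stays nonzero; the `+ 1` covers `ξ = 0`.
  set δ : ℝ := ‖v‖ / (2 * (‖ξ‖ + 1)) with hδ_def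
  have hδ : 0 < δ := by positivity
  have hδξ : δ * ‖ξ‖ < ‖v‖ := by
    rw [hδ_def, div_mul_eq_mul_div, div_lt_iff₀ (by positivity)]
    nlinarith [norm_nonneg ξ]
  have hne : ∀ t : ℝ, |t| ≤ δ → v + t • ξ ≠ 0 := by
    intro t ht h0
    have h1 : ‖v‖ = ‖t • ξ‖ := by rw [eq_neg_of_add_eq_zero_left h0, norm_neg]
    rw [norm_smul, Real.norm_eq_abs] at h1
    have h2 : |t| * ‖ξ‖ ≤ δ * ‖ξ‖ := by gcongr
    linarith
  have hcont : ContinuousOn (fun t : ℝ => weightedDeriv φ (v + t • ξ) ξ) (Icc (-δ) δ) :=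
    hφ.continuousOn_weightedDeriv.comp (f := fun t : ℝ => (v + t • ξ, ξ))
      (by fun_prop) fun t ht => hne t (abs_le.2 ht)
  obtain ⟨c, hc⟩ := isCompact_Icc.exists_bound_of_continuousOn hcont
  obtain ⟨C, hC⟩ := hdiss.exists_add_integral_nonneg hφ hI hA hK hηI hv ξ
  have hres : ∀ β g : ℝ → ℝ, (∀ x ∉ K, β x = 0) →
      ∫ x in I, β x ^ 2 * g x = ∫ x in K, β x ^ 2 * g x := by
    intro β g hβ
    refine setIntegral_eq_of_subset_of_forall_sdiff_eq_zero hI.measurableSet hηI fun x hx => ?_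
    rw [hβ x hx.2]
    simp
  have hint := integrableOn_complexOp hA hK hηI ξ
  have key := setIntegral_sq_mul_nonneg (C := C) hK
    (f := fun x t => energyForm φ (complexOp (A x) ξ) (v + t • ξ) ξ)
    (B := fun x => c * ‖complexOp (A x) ξ‖) hδ (hint.norm.const_mul c) ?_ ?_ ?_ ?_ hη le_rfl
  · simp only [zero_smul, add_zero] at key
    rwa [hres η _ fun x hx => image_eq_zero_of_notMem_tsupport hx]
  · intro β hβ hβδ
    simp_rw [energyForm_eq_inner]
    have h1 : Continuous fun x => weightedDeriv φ (v + β x • ξ) ξ :=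
      hcont.comp_continuous hβ fun x => abs_le.1 (hβδ x)
    exact h1.aestronglyMeasurable.inner hint.aestronglyMeasurable
  · intro x t ht
    simp only [energyForm_eq_inner]
    refine (abs_real_inner_le_norm _ _).trans ?_
    gcongr
    exact hc t (abs_le.1 ht)
  · intro x
    simp_rw [energyForm_eq_inner]
    exact (hcont.continuousAt (Icc_mem_nhds (by linarith) hδ)).inner continuousAt_const
  · intro β hβ hβK hβδ
    rw [← hres (deriv β) _ fun x hx => image_eq_zero_of_notMem_tsupport fun h =>
      hx (hβK (tsupport_deriv_subset h))]
    refine hC β hβ hβK fun x => lt_of_le_of_lt ?_ hδξ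
    gcongr
    exact hβδ x

/-- The exceptional null set depends on `(v, ξ)`. A countable dense set of pairs gives one null set,
and continuity of the form on the open set `v ≠ 0` covers the other pairs. -/
theorem LPhiDissipative.ae_forall_energyForm_nonneg {φ : ℝ → ℝ} (hφ : AdmissibleWeight φ)
    (hI : IsOpen I) (hA : ∀ i j, LocallyIntegrableOn (fun x => A x i j) I volume)
    (hdiss : LPhiDissipative φ I (fun x => (A x).map Complex.ofReal)) :
    ∀ᵐ x ∂(volume.restrict I), ∀ v ξ : EuclideanSpace ℂ (Fin m), v ≠ 0 →
      0 ≤ energyForm φ (complexOp (A x) ξ) v ξ := by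
  obtain ⟨D, hDc, hDd⟩ := TopologicalSpace.exists_countable_dense
    (EuclideanSpace ℂ (Fin m) × EuclideanSpace ℂ (Fin m))
  have hae : ∀ᵐ x ∂(volume.restrict I), ∀ z ∈ D, z.1 ≠ 0 →
      0 ≤ energyForm φ (complexOp (A x) z.2) z.1 z.2 := by
    rw [ae_ball_iff hDc]
    intro z _
    by_cases hz : z.1 = 0
    · exact ae_of_all _ fun x h => absurd hz h
    · exact (hdiss.ae_energyForm_nonneg hφ hI hA hz z.2).mono fun x hx _ => hx
  filter_upwards [hae] with x hx v ξ hv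
  by_contra! hneg
  have hcont : ContinuousOn (fun z : EuclideanSpace ℂ (Fin m) × EuclideanSpace ℂ (Fin m) =>
      energyForm φ (complexOp (A x) z.2) z.1 z.2) {z | z.1 ≠ 0} := by
    simp_rw [energyForm_eq_inner]
    exact hφ.continuousOn_weightedDeriv.inner
      ((complexOp (A x)).continuous.comp continuous_snd).continuousOn
  have hopen : IsOpen {z : EuclideanSpace ℂ (Fin m) × EuclideanSpace ℂ (Fin m) | z.1 ≠ 0} :=
    isOpen_ne_fun continuous_fst continuous_const
  have hU := hcont.isOpen_inter_preimage hopen (isOpen_Iio (a := (0 : ℝ)))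
  obtain ⟨z, hzU, hzD⟩ := hDd.inter_open_nonempty _ hU ⟨(v, ξ), hv, hneg⟩
  exact absurd (hx z hzD hzU.1) (not_le.2 hzU.2)

end Necessity

end PhiDissipativity

end

open PhiDissipativity in
theorem mainTheorem6 (φ : ℝ → ℝ) (hφ : AdmissibleWeight φ) (a b : EReal) (hab : a < b)
    (m : ℕ) (hm : 1 ≤ m) (A : ℝ → Matrix (Fin m) (Fin m) ℝ)
    (hAint : ∀ i j, LocallyIntegrableOn (fun x => A x i j) (openInterval a b) volume)
    (hApos : ∀ᵐ x ∂(volume.restrict (openInterval a b)), (A x).IsSymm ∧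
      ∀ ξ : Fin m → ℝ, ξ ≠ 0 → 0 < (A x).mulVec ξ ⬝ᵥ ξ) :
    (LPhiDissipative φ (openInterval a b) (fun x => (A x).map Complex.ofReal) ↔
      ∀ᵐ x ∂(volume.restrict (openInterval a b)),
        LambdaInftySq φ * (minEigenvalue (A x) + maxEigenvalue (A x)) ^ 2 ≤
          4 * (minEigenvalue (A x) * maxEigenvalue (A x))) ∧
    (m = 2 →
      ((∀ᵐ x ∂(volume.restrict (openInterval a b)),
        LambdaInftySq φ * (minEigenvalue (A x) + maxEigenvalue (A x)) ^ 2 ≤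
          4 * (minEigenvalue (A x) * maxEigenvalue (A x))) ↔
      ∀ᵐ x ∂(volume.restrict (openInterval a b)),
        LambdaInftySq φ * (A x).trace ^ 2 ≤ 4 * (A x).det)) := by
  have hI := isOpen_openInterval a b
  have hpt : ∀ᵐ x ∂(volume.restrict (openInterval a b)),
      ((∀ v ξ : EuclideanSpace ℂ (Fin m), v ≠ 0 → 0 ≤ energyForm φ (complexOp (A x) ξ) v ξ) ↔
        LambdaInftySq φ * (minEigenvalue (A x) + maxEigenvalue (A x)) ^ 2 ≤
          4 * (minEigenvalue (A x) * maxEigenvalue (A x))) :=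
    hApos.mono fun x hx => forall_energyForm_nonneg_iff hφ hm hx.1 hx.2
  refine ⟨⟨fun hdiss => ?_, fun hcond => ?_⟩, ?_⟩
  · filter_upwards [hpt, hdiss.ae_forall_energyForm_nonneg hφ hI hAint] with x hx h
    exact hx.1 h
  · refine lPhiDissipative_of_ae hφ hI hAint ?_
    filter_upwards [hpt, hcond] with x hx h
    exact hx.2 h
  · rintro rfl
    refine eventually_congr (hApos.mono fun x hx => ?_)
    obtain ⟨h1, h2⟩ := eigenvalue_sum_prod_of_two (isHermitian_of_isSymm hx.1)
    rw [h1, h2]
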